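/- Let $M$ be a smooth manifold of dimension $2n+1$. **Definitions.** A paracontact metric structure $(\varphi,\xi,\eta,g)$ on $M$ consists of a smooth $(1,1)$-tensor field $\varphi$, a smooth vector field $\xi$, a smooth $1$-form $\eta$ and a semi-Riemannian metric $g$ such that $\eta(\xi)=1$, $\varphi^2=I-\eta\otimes\xi$, the eigenspaces of $\varphi$ for the eigenvalues $1$ and $-1$ both have dimension $n$ at every point, $g(\varphi X,\varphi Y)=-g(X,Y)+\eta(X)\eta(Y)$, and $d\eta(X,Y)=g(X,\varphi Y)$, where $d\eta(X,Y)=\frac12\big(X(\eta(Y))-Y(\eta(X))-\eta([X,Y])\big)$. Put $h=\frac12 L_\xi\varphi$. The manifold is paraSasakian if moreover $[\varphi,\varphi]-2d\eta\otimes\xi=0$, where $[\varphi,\varphi](X,Y)=\varphi^2[X,Y]+[\varphi X,\varphi Y]-\varphi[\varphi X,Y]-\varphi[X,\varphi Y]$. For constants $\kappa,\mu\in\mathbb R$ it is a paracontact metric $(\kappa,\mu)$-space if $$R(X,Y)\xi=\kappa\big(\eta(Y)X-\eta(X)Y\big)+\mu\big(\eta(Y)hX-\eta(X)hY\big)$$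 for all vector fields $X,Y$, where $R(X,Y)Z=\nabla_X\nabla_YZ-\nabla_Y\nabla_XZ-\nabla_{[X,Y]}Z$ is the curvature of the Levi-Civita connection of $g$. **Theorem 2.1.** Let $M$ be a $(2n+1)$-dimensional paracontact metric $(-1,\mu)$-space. Then one of the following holds. 1. $h=0$ on $M$ and $M$ is paraSasakian. 2. $h\neq0$, and for every $p\in M$ with $h_p\neq0$: (a) $\operatorname{rank}(h_p)\in\{1,\dots,n\}$. (b) There is a basis $\{\xi_p,X_1,Y_1,\dots,X_n,Y_n\}$ of $T_pM$ in which the only non-vanishing components of $g$ are $g_p(\xi_p,\xi_p)=1$ and $g_p(X_i,Y_i)=\pm1$ (the sign may depend on $i$), and such that for each $i$ the restriction of $h_p$ to $\langle X_i,Y_i\rangle$ has, with respect to $(X_i,Y_i)$, the matrix $\begin{pmatrix}0&0\\1&0\end{pmatrix}$ (that is, $h_pX_i=Y_i$ and $h_pY_i=0$) or $\begin{pmatrix}0&0\\0&0\end{pmatrix}$. (c) For every basis as in (b), exactly $\operatorname{rank}(h_p)$ of the matrices are of the first type. If $n=1$, every such basis $\{\xi_p,X_1,Y_1\}$ also satisfies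 $\varphi_pX_1=\pm X_1$, $\varphi_pY_1=\mp Y_1$, and $h_p\xi_p=0$, $h_pX_1=Y_1$, $h_pY_1=0$. -/

import Mathlib

open scoped Manifold ContDiff Bundle

set_option linter.unusedSectionVars false

noncomputable section

namespace Paracontact

universe u v

section SemiRiemannian

variable {E : Type u} [NormedAddCommGroup E] [NormedSpace ℝ E] [FiniteDimensional ℝ E]
  {M : Type v} [TopologicalSpace M] [ChartedSpace E M] [IsManifold 𝓘(ℝ, E) ∞ M]

variable (E M) in
/-- Vector fields on `M` (rough sections of the tangent bundle; smoothness is always imposed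
separately). -/
abbrev VField := Π x : M, TangentSpace 𝓘(ℝ, E) x

/-- The vector field `X` is differentiable at `x`. -/
abbrev DiffAt (X : VField E M) (x : M) : Prop :=
  MDifferentiableAt 𝓘(ℝ, E) (𝓘(ℝ, E).prod 𝓘(ℝ, E))
    (fun y ↦ Bundle.TotalSpace.mk' E (E := fun y : M ↦ TangentSpace 𝓘(ℝ, E) y) y (X y)) x

/-- The vector field `X` is smooth on a neighbourhood of `x`. -/
abbrev SmoothAt (X : VField E M) (x : M) : Prop :=
  ContMDiffAt 𝓘(ℝ, E) (𝓘(ℝ, E).prod 𝓘(ℝ, E)) ∞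
    (fun y ↦ Bundle.TotalSpace.mk' E (E := fun y : M ↦ TangentSpace 𝓘(ℝ, E) y) y (X y)) x

/-- `X f` at the point `x`: the derivative of the function `f` in the direction `X x`. -/
abbrev dirDeriv (X : VField E M) (f : M → ℝ) (x : M) : ℝ := mvfderiv 𝓘(ℝ, E) f x (X x)

/-- The Lie bracket of vector fields. -/
abbrev bracket (X Y : VField E M) : VField E M := VectorField.mlieBracket 𝓘(ℝ, E) X Y

variable (E M) in
/-- A semi-Riemannian metric: a smooth symmetric nondegenerate `(0,2)`-tensor field. -/
structure SemiRiemannianMetric where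
  /-- The scalar product on each tangent space. -/
  val : Π x : M, TangentSpace 𝓘(ℝ, E) x →L[ℝ] TangentSpace 𝓘(ℝ, E) x →L[ℝ] ℝ
  symm : ∀ (x : M) (v w : TangentSpace 𝓘(ℝ, E) x), val x v w = val x w v
  nondegenerate : ∀ (x : M) (v : TangentSpace 𝓘(ℝ, E) x), (∀ w, val x v w = 0) → v = 0
  smooth : ContMDiff 𝓘(ℝ, E) (𝓘(ℝ, E).prod 𝓘(ℝ, E →L[ℝ] E →L[ℝ] ℝ)) ∞
    (fun x ↦ Bundle.TotalSpace.mk' (E →L[ℝ] E →L[ℝ] ℝ)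
      (E := fun x : M ↦ TangentSpace 𝓘(ℝ, E) x →L[ℝ] TangentSpace 𝓘(ℝ, E) x →L[ℝ] ℝ) x (val x))

namespace SemiRiemannianMetric

variable (g : SemiRiemannianMetric E M)

/-- The function `g(X, Y)`. -/
abbrev pair (X Y : VField E M) : M → ℝ := fun x ↦ g.val x (X x) (Y x)

lemma mdifferentiableAt_pair {X Y : VField E M} {x : M} (hX : DiffAt X x) (hY : DiffAt Y x) :
    MDifferentiableAt 𝓘(ℝ, E) 𝓘(ℝ, ℝ) (g.pair X Y) x := by
  have h := (g.smooth x).mdifferentiableAt (by simp)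
  have h2 : MDifferentiableAt 𝓘(ℝ, E) (𝓘(ℝ, E).prod 𝓘(ℝ, ℝ))
      (fun m ↦ Bundle.TotalSpace.mk' ℝ (E := Bundle.Trivial M ℝ) m (g.val m (X m) (Y m))) x :=
    MDifferentiableAt.clm_bundle_apply₂ h hX hY
  rw [mdifferentiableAt_totalSpace] at h2
  exact h2.2

lemma deriv_pair_add_left {X X' Y : VField E M} {x : M} (hX : DiffAt X x) (hX' : DiffAt X' x)
    (hY : DiffAt Y x) : mvfderiv 𝓘(ℝ, E) (g.pair (X + X') Y) x =
      mvfderiv 𝓘(ℝ, E) (g.pair X Y) x + mvfderiv 𝓘(ℝ, E) (g.pair X' Y) x := by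
  rw [← mvfderiv_add (g.mdifferentiableAt_pair hX hY) (g.mdifferentiableAt_pair hX' hY)]
  congr 1
  ext y
  simp [pair]

lemma deriv_pair_smul_left {X Y : VField E M} {f : M → ℝ} {x : M}
    (hf : MDifferentiableAt 𝓘(ℝ, E) 𝓘(ℝ, ℝ) f x) (hX : DiffAt X x)
    (hY : DiffAt Y x) : mvfderiv 𝓘(ℝ, E) (g.pair (f • X) Y) x =
      f x • mvfderiv 𝓘(ℝ, E) (g.pair X Y) x + g.pair X Y x • mvfderiv 𝓘(ℝ, E) f x := by
  rw [← mvfderiv_mul hf (g.mdifferentiableAt_pair hX hY)]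
  congr 1
  ext y
  simp [pair]

lemma pair_comm (X Y : VField E M) : g.pair X Y = g.pair Y X := by
  ext y
  exact g.symm y _ _

lemma deriv_pair_add_right {X Y Y' : VField E M} {x : M} (hX : DiffAt X x) (hY : DiffAt Y x)
    (hY' : DiffAt Y' x) : mvfderiv 𝓘(ℝ, E) (g.pair X (Y + Y')) x =
      mvfderiv 𝓘(ℝ, E) (g.pair X Y) x + mvfderiv 𝓘(ℝ, E) (g.pair X Y') x := by
  rw [g.pair_comm, g.deriv_pair_add_left hY hY' hX, g.pair_comm Y, g.pair_comm Y']

lemma deriv_pair_smul_right {X Y : VField E M} {f : M → ℝ} {x : M}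
    (hf : MDifferentiableAt 𝓘(ℝ, E) 𝓘(ℝ, ℝ) f x) (hX : DiffAt X x)
    (hY : DiffAt Y x) : mvfderiv 𝓘(ℝ, E) (g.pair X (f • Y)) x =
      f x • mvfderiv 𝓘(ℝ, E) (g.pair X Y) x + g.pair X Y x • mvfderiv 𝓘(ℝ, E) f x := by
  rw [g.pair_comm, g.deriv_pair_smul_left hf hY hX, g.pair_comm Y]

/-- The right-hand side of the Koszul formula for `2 g(∇_X Y, Z)`. -/
def koszul (X Y Z : VField E M) (x : M) : ℝ :=
  dirDeriv X (g.pair Y Z) x + dirDeriv Y (g.pair Z X) x - dirDeriv Z (g.pair X Y) x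
    - g.pair X (bracket Y Z) x - g.pair Y (bracket X Z) x + g.pair Z (bracket X Y) x

lemma koszul_tensorial_left {Y Z : VField E M} {x : M} (hY : DiffAt Y x) (hZ : DiffAt Z x) :
    TensorialAt 𝓘(ℝ, E) E (fun X : VField E M ↦ g.koszul X Y Z x) x where
  smul {f X} hf hX := by
    simp only [koszul, dirDeriv, g.deriv_pair_smul_left hf hX hY, g.deriv_pair_smul_right hf hZ hX,
      bracket, pair, VectorField.mlieBracket_smul_left hf hX]
    simp [g.symm x (Z x), g.symm x (Y x) (X x)]
    ring
  add {X X'} hX hX' := by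
    simp only [koszul, dirDeriv, g.deriv_pair_add_left hX hX' hY, g.deriv_pair_add_right hZ hX hX',
      bracket, pair, VectorField.mlieBracket_add_left hX hX']
    simp
    ring

lemma koszul_tensorial_right {X Y : VField E M} {x : M} (hX : DiffAt X x) (hY : DiffAt Y x) :
    TensorialAt 𝓘(ℝ, E) E (fun Z : VField E M ↦ g.koszul X Y Z x) x where
  smul {f Z} hf hZ := by
    simp only [koszul, dirDeriv, g.deriv_pair_smul_left hf hZ hX, g.deriv_pair_smul_right hf hY hZ,
      bracket, pair, VectorField.mlieBracket_smul_right hf hZ]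
    simp [g.symm x (Z x)]
    ring
  add {Z Z'} hZ hZ' := by
    simp only [koszul, dirDeriv, g.deriv_pair_add_left hZ hZ' hX, g.deriv_pair_add_right hY hZ hZ',
      bracket, pair, VectorField.mlieBracket_add_right hZ hZ']
    simp
    ring

lemma koszul_add_mid {X Y Y' Z : VField E M} {x : M} (hX : DiffAt X x) (hY : DiffAt Y x)
    (hY' : DiffAt Y' x) (hZ : DiffAt Z x) :
    g.koszul X (Y + Y') Z x = g.koszul X Y Z x + g.koszul X Y' Z x := by
  simp only [koszul, dirDeriv, g.deriv_pair_add_left hY hY' hZ, g.deriv_pair_add_right hX hY hY',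
      bracket, pair, VectorField.mlieBracket_add_right hY hY',
      VectorField.mlieBracket_add_left hY hY']
  simp
  ring

lemma koszul_smul_mid {X Y Z : VField E M} {f : M → ℝ} {x : M}
    (hf : MDifferentiableAt 𝓘(ℝ, E) 𝓘(ℝ, ℝ) f x) (hX : DiffAt X x) (hY : DiffAt Y x)
    (hZ : DiffAt Z x) :
    g.koszul X (f • Y) Z x = f x * g.koszul X Y Z x
      + 2 * mvfderiv 𝓘(ℝ, E) f x (X x) * g.val x (Y x) (Z x) := by
  simp only [koszul, dirDeriv, g.deriv_pair_smul_left hf hY hZ, g.deriv_pair_smul_right hf hX hY,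
      bracket, pair, VectorField.mlieBracket_smul_right hf hY,
      VectorField.mlieBracket_smul_left hf hY]
  simp [g.symm x (Z x)]
  ring

/-- The linear isomorphism `v ↦ g(v, ·)` from a tangent space to its dual. -/
def flat (x : M) : TangentSpace 𝓘(ℝ, E) x ≃ₗ[ℝ] (TangentSpace 𝓘(ℝ, E) x →L[ℝ] ℝ) :=
  have : FiniteDimensional ℝ (TangentSpace 𝓘(ℝ, E) x) := inferInstanceAs (FiniteDimensional ℝ E)
  have : T2Space (TangentSpace 𝓘(ℝ, E) x) := inferInstanceAs (T2Space E)
  LinearMap.linearEquivOfInjective (g.val x).toLinearMap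
    ((injective_iff_map_eq_zero _).2 fun v hv ↦ g.nondegenerate x v fun w ↦ by
      simpa using congrArg (fun L : TangentSpace 𝓘(ℝ, E) x →L[ℝ] ℝ ↦ L w) hv)
    (by
      let e : Module.Dual ℝ (TangentSpace 𝓘(ℝ, E) x) ≃ₗ[ℝ] (TangentSpace 𝓘(ℝ, E) x →L[ℝ] ℝ) :=
        LinearMap.toContinuousLinearMap
      rw [← e.finrank_eq]
      exact Subspace.dual_finrank_eq.symm)

lemma val_flat_symm (x : M) (α : TangentSpace 𝓘(ℝ, E) x →L[ℝ] ℝ) (w : TangentSpace 𝓘(ℝ, E) x) :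
    g.val x ((g.flat x).symm α) w = α w :=
  congrArg (fun L : TangentSpace 𝓘(ℝ, E) x →L[ℝ] ℝ ↦ L w) ((g.flat x).apply_symm_apply α)

open Classical in
/-- The Levi-Civita connection as an operator, `leviCivitaFun Y x v = (∇_v Y)(x)`: the vector
determined by the Koszul formula (and `0` by convention where `Y` is not differentiable). -/
def leviCivitaFun (Y : VField E M) (x : M) :
    TangentSpace 𝓘(ℝ, E) x →L[ℝ] TangentSpace 𝓘(ℝ, E) x :=
  if hY : DiffAt Y x then
    have : FiniteDimensional ℝ (TangentSpace 𝓘(ℝ, E) x) := inferInstanceAs (FiniteDimensional ℝ E)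
    have : T2Space (TangentSpace 𝓘(ℝ, E) x) := inferInstanceAs (T2Space E)
    LinearMap.toContinuousLinearMap ((1 / 2 : ℝ) • ((g.flat x).symm.toLinearMap ∘ₗ
      (TensorialAt.mkHom₂ (I := 𝓘(ℝ, E)) (F := E) (F' := E)
        (fun X Z : VField E M ↦ g.koszul X Y Z x) x
        (fun _ hZ ↦ g.koszul_tensorial_left hY hZ)
        (fun _ hX ↦ g.koszul_tensorial_right hX hY)).toLinearMap))
  else 0

/-- The Koszul formula. -/
lemma koszul_formula {X Y Z : VField E M} {x : M} (hX : DiffAt X x) (hY : DiffAt Y x)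
    (hZ : DiffAt Z x) :
    2 * g.val x (g.leviCivitaFun Y x (X x)) (Z x) = g.koszul X Y Z x := by
  rw [leviCivitaFun, dif_pos hY, ← TensorialAt.mkHom₂_apply (I := 𝓘(ℝ, E)) (F := E) (F' := E)
        (Φ := fun X Z : VField E M ↦ g.koszul X Y Z x)
        (fun _ hZ ↦ g.koszul_tensorial_left hY hZ)
        (fun _ hX ↦ g.koszul_tensorial_right hX hY) hX hZ]
  simp [val_flat_symm]

lemma exists_ext (x : M) (v : TangentSpace 𝓘(ℝ, E) x) :
    ∃ X : VField E M, DiffAt X x ∧ X x = v :=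
  ⟨FiberBundle.extend E v, FiberBundle.mdifferentiableAt_extend .., by simp⟩

lemma eq_of_pair_eq {x : M} {v w : TangentSpace 𝓘(ℝ, E) x}
    (h : ∀ Z : VField E M, DiffAt Z x → 2 * g.val x v (Z x) = 2 * g.val x w (Z x)) : v = w := by
  rw [← sub_eq_zero]
  refine g.nondegenerate x _ fun u ↦ ?_
  obtain ⟨Z, hZ, rfl⟩ := exists_ext x u
  simp only [map_sub, sub_apply]
  linarith [h Z hZ]

/-- The Levi-Civita connection of a semi-Riemannian metric; `leviCivita Y x (X x)` is `∇_X Y` at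
`x`. -/
def leviCivita : CovariantDerivative 𝓘(ℝ, E) E (fun x : M ↦ TangentSpace 𝓘(ℝ, E) x) where
  toFun := g.leviCivitaFun
  isCovariantDerivativeOnUniv :=
    { add := by
        intro Y Y' x hY hY' _
        ext v
        obtain ⟨X, hX, rfl⟩ := exists_ext x v
        refine g.eq_of_pair_eq fun Z hZ ↦ ?_
        have hs : DiffAt (Y + Y') x := mdifferentiableAt_add_section hY hY'
        rw [g.koszul_formula hX hs hZ, g.koszul_add_mid hX hY hY' hZ,
          ← g.koszul_formula hX hY hZ, ← g.koszul_formula hX hY' hZ]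
        simp
        ring
      leibniz := by
        intro Y f x hY hf _
        ext v
        obtain ⟨X, hX, rfl⟩ := exists_ext x v
        refine g.eq_of_pair_eq fun Z hZ ↦ ?_
        have hs : DiffAt (f • Y) x := hf.smul_section hY
        rw [g.koszul_formula hX hs hZ, g.koszul_smul_mid hf hX hY hZ,
          ← g.koszul_formula hX hY hZ]
        simp
        ring }

/-- The Levi-Civita connection is torsion-free. -/
lemma leviCivita_torsion : g.leviCivita.torsion = 0 := by
  rw [CovariantDerivative.torsion_eq_zero_iff]
  intro X Y x hX hY
  refine g.eq_of_pair_eq fun Z hZ ↦ ?_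
  have h1 := g.koszul_formula hX hY hZ
  have h2 := g.koszul_formula hY hX hZ
  have h3 : g.val x (Z x) (bracket Y X x) = - g.val x (Z x) (bracket X Y x) := by
    rw [bracket, VectorField.mlieBracket_swap_apply]
    simp
  simp only [koszul, g.pair_comm Y X, g.pair_comm Z X, g.pair_comm Z Y] at h1 h2
  simp only [pair] at h1 h2
  rw [map_sub, sub_apply, g.symm x (VectorField.mlieBracket 𝓘(ℝ, E) X Y x)]
  change 2 * (g.val x (g.leviCivitaFun Y x (X x)) (Z x) -
    g.val x (g.leviCivitaFun X x (Y x)) (Z x)) = 2 * g.val x (Z x) (bracket X Y x)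
  linarith

/-- The Levi-Civita connection is metric. -/
lemma leviCivita_metric {X Y Z : VField E M} {x : M} (hX : DiffAt X x) (hY : DiffAt Y x)
    (hZ : DiffAt Z x) :
    dirDeriv X (g.pair Y Z) x =
      g.val x (g.leviCivita Y x (X x)) (Z x) + g.val x (Y x) (g.leviCivita Z x (X x)) := by
  change _ = g.val x (g.leviCivitaFun Y x (X x)) (Z x) + g.val x (Y x) (g.leviCivitaFun Z x (X x))
  have h1 := g.koszul_formula hX hY hZ
  have h2 := g.koszul_formula hX hZ hY
  rw [g.symm x (Y x)]
  have h3 : g.val x (X x) (bracket Z Y x) = - g.val x (X x) (bracket Y Z x) := by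
    rw [bracket, VectorField.mlieBracket_swap_apply]
    simp
  simp only [koszul, g.pair_comm Y X, g.pair_comm Z X, g.pair_comm Z Y] at h1 h2
  simp only [pair] at h1 h2
  linarith

/-- The curvature `R(X, Y) Z = ∇_X ∇_Y Z - ∇_Y ∇_X Z - ∇_{[X, Y]} Z` of the Levi-Civita
connection. -/
def curvature (X Y Z : VField E M) (x : M) : TangentSpace 𝓘(ℝ, E) x :=
  g.leviCivita (fun y ↦ g.leviCivita Z y (Y y)) x (X x)
    - g.leviCivita (fun y ↦ g.leviCivita Z y (X y)) x (Y x)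
    - g.leviCivita Z x (bracket X Y x)

end SemiRiemannianMetric

/-- The exterior derivative of a 1-form, with the normalisation
`dη(X, Y) = (X(η(Y)) - Y(η(X)) - η([X, Y])) / 2`. -/
def extDeriv (η : Π x : M, TangentSpace 𝓘(ℝ, E) x →L[ℝ] ℝ) (X Y : VField E M) (x : M) : ℝ :=
  (1 / 2) * (dirDeriv X (fun y ↦ η y (Y y)) x - dirDeriv Y (fun y ↦ η y (X y)) x
    - η x (bracket X Y x))

/-- The image `φ X` of a vector field under a `(1,1)`-tensor field. -/
abbrev appl (φ : Π x : M, TangentSpace 𝓘(ℝ, E) x →L[ℝ] TangentSpace 𝓘(ℝ, E) x)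
    (X : VField E M) : VField E M := fun x ↦ φ x (X x)

/-- The Lie derivative `(L_V φ) X = [V, φ X] - φ [V, X]` of a `(1,1)`-tensor field. -/
def lieDeriv (V : VField E M)
    (φ : Π x : M, TangentSpace 𝓘(ℝ, E) x →L[ℝ] TangentSpace 𝓘(ℝ, E) x)
    (X : VField E M) (x : M) : TangentSpace 𝓘(ℝ, E) x :=
  bracket V (appl φ X) x - φ x (bracket V X x)

/-- The Nijenhuis tensor `[φ, φ]` of a `(1,1)`-tensor field. -/
def nijenhuis (φ : Π x : M, TangentSpace 𝓘(ℝ, E) x →L[ℝ] TangentSpace 𝓘(ℝ, E) x)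
    (X Y : VField E M) (x : M) : TangentSpace 𝓘(ℝ, E) x :=
  φ x (φ x (bracket X Y x)) + bracket (appl φ X) (appl φ Y) x
    - φ x (bracket (appl φ X) Y x) - φ x (bracket X (appl φ Y) x)

end SemiRiemannian

section Structures

variable (n : ℕ) (M : Type v) [TopologicalSpace M]
  [ChartedSpace (EuclideanSpace ℝ (Fin (2 * n + 1))) M]
  [IsManifold 𝓘(ℝ, EuclideanSpace ℝ (Fin (2 * n + 1))) ∞ M]

/-- The model space of a `(2n+1)`-dimensional manifold. -/
abbrev Model (n : ℕ) : Type := EuclideanSpace ℝ (Fin (2 * n + 1))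

/-- An almost paracontact structure `(φ, ξ, η)` on a `(2n+1)`-dimensional smooth manifold. -/
structure AlmostParacontact where
  φ : Π x : M, TangentSpace 𝓘(ℝ, Model n) x →L[ℝ] TangentSpace 𝓘(ℝ, Model n) x
  ξ : VField (Model n) M
  η : Π x : M, TangentSpace 𝓘(ℝ, Model n) x →L[ℝ] ℝ
  smooth_φ : ContMDiff 𝓘(ℝ, Model n) (𝓘(ℝ, Model n).prod 𝓘(ℝ, Model n →L[ℝ] Model n)) ∞
    (fun x ↦ Bundle.TotalSpace.mk' (Model n →L[ℝ] Model n)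
      (E := fun x : M ↦ TangentSpace 𝓘(ℝ, Model n) x →L[ℝ] TangentSpace 𝓘(ℝ, Model n) x) x (φ x))
  smooth_ξ : ∀ x, SmoothAt ξ x
  smooth_η : ContMDiff 𝓘(ℝ, Model n) (𝓘(ℝ, Model n).prod 𝓘(ℝ, Model n →L[ℝ] ℝ)) ∞
    (fun x ↦ Bundle.TotalSpace.mk' (Model n →L[ℝ] ℝ)
      (E := fun x : M ↦ TangentSpace 𝓘(ℝ, Model n) x →L[ℝ] ℝ) x (η x))
  η_ξ : ∀ x, η x (ξ x) = 1
  φ_sq : ∀ (x : M) (v : TangentSpace 𝓘(ℝ, Model n) x), φ x (φ x v) = v - η x v • ξ x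
  finrank_pos : ∀ x, Module.finrank ℝ (Module.End.eigenspace (φ x).toLinearMap (1 : ℝ)) = n
  finrank_neg : ∀ x, Module.finrank ℝ (Module.End.eigenspace (φ x).toLinearMap (-1 : ℝ)) = n

/-- A paracontact metric manifold `(M, φ, ξ, η, g)`: an almost paracontact structure with a
compatible semi-Riemannian metric such that `dη(X, Y) = g(X, φ Y)`. -/
structure ParacontactMetric extends AlmostParacontact n M where
  g : SemiRiemannianMetric (Model n) M
  compatible : ∀ (x : M) (v w : TangentSpace 𝓘(ℝ, Model n) x),
    g.val x (φ x v) (φ x w) = - g.val x v w + η x v * η x w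
  d_η : ∀ (x : M) (X Y : VField (Model n) M), SmoothAt X x → SmoothAt Y x →
    extDeriv η X Y x = g.val x (X x) (φ x (Y x))

variable {n M}

lemma AlmostParacontact.diffAt_appl (S : AlmostParacontact n M) {X : VField (Model n) M} {x : M}
    (hX : DiffAt X x) : DiffAt (appl S.φ X) x :=
  MDifferentiableAt.clm_bundle_apply ((S.smooth_φ x).mdifferentiableAt (by simp)) hX

/-- `(L_ξ φ) X` at `x` is tensorial in `X`. -/
lemma AlmostParacontact.lieDeriv_tensorial (S : AlmostParacontact n M) (x : M) :
    TensorialAt 𝓘(ℝ, Model n) (Model n)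
      (fun X : VField (Model n) M ↦ lieDeriv S.ξ S.φ X x) x where
  smul {f X} hf hX := by
    have h : appl S.φ (f • X) = f • appl S.φ X := by
      ext1 y
      simp [appl]
    simp only [lieDeriv, h, bracket, VectorField.mlieBracket_smul_right hf hX,
      VectorField.mlieBracket_smul_right hf (S.diffAt_appl hX)]
    simp [smul_sub]
  add {X X'} hX hX' := by
    have h : appl S.φ (X + X') = appl S.φ X + appl S.φ X' := by
      ext1 y
      simp [appl]
    simp only [lieDeriv, h, bracket, VectorField.mlieBracket_add_right hX hX',
      VectorField.mlieBracket_add_right (S.diffAt_appl hX) (S.diffAt_appl hX')]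
    simp
    abel

/-- The tensor field `h = (1/2) L_ξ φ`, as an endomorphism of each tangent space. -/
def AlmostParacontact.h (S : AlmostParacontact n M) (x : M) :
    TangentSpace 𝓘(ℝ, Model n) x →L[ℝ] TangentSpace 𝓘(ℝ, Model n) x :=
  (1 / 2 : ℝ) • TensorialAt.mkHom (I := 𝓘(ℝ, Model n)) (F := Model n)
    (fun X : VField (Model n) M ↦ lieDeriv S.ξ S.φ X x) x (S.lieDeriv_tensorial x)

lemma AlmostParacontact.h_apply (S : AlmostParacontact n M) {X : VField (Model n) M} {x : M}
    (hX : DiffAt X x) : S.h x (X x) = (1 / 2 : ℝ) • lieDeriv S.ξ S.φ X x := by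
  rw [AlmostParacontact.h, smul_apply,
    TensorialAt.mkHom_apply (S.lieDeriv_tensorial x) hX]

/-- Normality: `[φ, φ] - 2 dη ⊗ ξ = 0`. -/
def AlmostParacontact.IsNormal (S : AlmostParacontact n M) : Prop :=
  ∀ (x : M) (X Y : VField (Model n) M), SmoothAt X x → SmoothAt Y x →
    nijenhuis S.φ X Y x - (2 * extDeriv S.η X Y x) • S.ξ x = 0

namespace ParacontactMetric

/-- A paraSasakian manifold is a normal paracontact metric manifold. -/
def IsParaSasakian (S : ParacontactMetric n M) : Prop := S.IsNormal

/-- A paracontact metric `(κ, μ)`-space: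
`R(X, Y) ξ = κ (η(Y) X - η(X) Y) + μ (η(Y) h X - η(X) h Y)` for all vector fields `X`, `Y`. -/
def IsKappaMuSpace (S : ParacontactMetric n M) (κ μ : ℝ) : Prop :=
  ∀ (x : M) (X Y : VField (Model n) M), SmoothAt X x → SmoothAt Y x →
    S.g.curvature X Y S.ξ x =
      κ • (S.η x (Y x) • X x - S.η x (X x) • Y x)
        + μ • (S.η x (Y x) • S.h x (X x) - S.η x (X x) • S.h x (Y x))

/-- The rank of `h` at the point `p`. -/
def rankH (S : ParacontactMetric n M) (p : M) : ℕ :=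
  Module.finrank ℝ (LinearMap.range (S.h p).toLinearMap)

/-- `b` is a basis `{ξ_p, X_1, Y_1, …, X_n, Y_n}` of `T_p M`, with `X_i = b (inr (inl i))` and
`Y_i = b (inr (inr i))`, whose only nonvanishing metric components are `g(ξ_p, ξ_p) = 1` and
`g(X_i, Y_i) = ±1`, and such that on each plane `⟨X_i, Y_i⟩` either `h X_i = Y_i`, `h Y_i = 0`
or `h X_i = h Y_i = 0`. -/
structure IsAdapted (S : ParacontactMetric n M) (p : M)
    (b : Module.Basis (Unit ⊕ (Fin n ⊕ Fin n)) ℝ (TangentSpace 𝓘(ℝ, Model n) p)) : Prop where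
  reeb : b (.inl ()) = S.ξ p
  g_ξ_ξ : S.g.val p (S.ξ p) (S.ξ p) = 1
  g_ξ : ∀ k, S.g.val p (S.ξ p) (b (.inr k)) = 0
  g_X_X : ∀ i j, S.g.val p (b (.inr (.inl i))) (b (.inr (.inl j))) = 0
  g_Y_Y : ∀ i j, S.g.val p (b (.inr (.inr i))) (b (.inr (.inr j))) = 0
  g_X_Y_ne : ∀ i j, i ≠ j → S.g.val p (b (.inr (.inl i))) (b (.inr (.inr j))) = 0
  g_X_Y : ∀ i, S.g.val p (b (.inr (.inl i))) (b (.inr (.inr i))) = 1 ∨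
    S.g.val p (b (.inr (.inl i))) (b (.inr (.inr i))) = -1
  h_block : ∀ i,
    (S.h p (b (.inr (.inl i))) = b (.inr (.inr i)) ∧ S.h p (b (.inr (.inr i))) = 0) ∨
    (S.h p (b (.inr (.inl i))) = 0 ∧ S.h p (b (.inr (.inr i))) = 0)

end ParacontactMetric

end Structures

end Paracontact

end

/-!
Write `A = ∇ξ` for the covariant derivative of the Reeb field. The condition `dη(X, Y) = g(X, φ Y)`
says that the skew part of `A` is `-φ` (`nabla_ξ_sub`). It also makes the form `g(X, φ Y)` exact,
hence closed; in terms of the Levi-Civita connection this means that the cyclic sum of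
`g((∇_X φ) Y, Z)` vanishes (`g_nablaφ_cyclic`). Putting one argument equal to `ξ` expresses `∇_ξ φ`
through `A` and `φ`, as an operator that commutes with `φ` (`nablaφ_along_ξ_eq`), whereas differentiating `φ² = 1 - η ⊗ ξ` shows that it anticommutes with `φ`.
Hence `∇_ξ φ = 0` (`nablaφ_along_ξ`), and `A = -φ + φ h` with `h` self-adjoint and anticommuting
with `φ` (`nabla_ξ_eq`, `h_symm`, `h_φ`).

Substituting `A = -φ + φ h` into the curvature gives `R(ξ, X) ξ = φ (∇_ξ h) X + φ² X - h² X`.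
Compare with the `(-1, μ)` condition, `R(ξ, X) ξ = φ² X - μ h X`, at `X` and at `φ X`: the terms
`φ (∇_ξ h)` and `h` anticommute with `φ`, the term `h²` commutes with it, so `h² = 0` (`h_h`).

If `h` vanishes identically, then `A = -φ` and the full curvature condition gives the part of
`g((∇_X φ) Y, Z)` that is skew in `X, Y`. Together with the cyclic identity this determines
`(∇_X φ) Y = η(Y) X - g(X, Y) ξ` (`nablaφ_eq`), which is equivalent to normality
(`isParaSasakian`).

At a point where `h ≠ 0` the rest is linear algebra for a self-adjoint operator with `h² = 0`,
`h φ = -φ h`, `h ξ = 0`. On any `φ`- and `h`-invariant nondegenerate subspace of `ker η`, either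
some eigenvector `e` of `φ` has `g(h e, e) ≠ 0`, and after scaling `(e, h e)` is a hyperbolic pair,
or `h` vanishes there by polarization, and any dual pair of eigenvectors of `φ` will do
(`exists_hyperbolic_pair`). Splitting off such planes one at a time yields the adapted basis. In
any adapted basis the vectors `Y_i` of the nonzero blocks form a basis of the range of `h`, which
gives the rank statements (`IsAdapted.ncard_eq`).
-/

noncomputable section

namespace Paracontact

universe u v

open Filter Topology

/-! ### Lie brackets of vector fields of finite regularity -/

section Calculus

variable {E : Type u} [NormedAddCommGroup E] [NormedSpace ℝ E] [FiniteDimensional ℝ E]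
  {M : Type v} [TopologicalSpace M] [ChartedSpace E M] [IsManifold 𝓘(ℝ, E) ∞ M]

/-- The vector field `X` is of class `C^k` at `x`. The order is finite because this condition,
unlike `SmoothAt`, automatically holds at all points near `x`. -/
abbrev RegAt (k : ℕ) (X : VField E M) (x : M) : Prop :=
  ContMDiffAt 𝓘(ℝ, E) (𝓘(ℝ, E).prod 𝓘(ℝ, E)) k
    (fun y ↦ Bundle.TotalSpace.mk' E (E := fun y : M ↦ TangentSpace 𝓘(ℝ, E) y) y (X y)) x

lemma RegAt.diffAt {k : ℕ} {X : VField E M} {x : M} (hX : RegAt (k + 1) X x) : DiffAt X x :=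
  ContMDiffAt.mdifferentiableAt hX (by simp)

lemma SmoothAt.regAt {X : VField E M} {x : M} (hX : SmoothAt X x) (k : ℕ) : RegAt k X x :=
  ContMDiffAt.of_le hX (by exact_mod_cast le_top)

lemma SmoothAt.diffAt {X : VField E M} {x : M} (hX : SmoothAt X x) : DiffAt X x :=
  ContMDiffAt.mdifferentiableAt hX (by simp)

lemma RegAt.eventually {k : ℕ} {X : VField E M} {x : M} (hX : RegAt k X x) :
    ∀ᶠ y in 𝓝 x, RegAt k X y :=
  (contMDiffAt_iff_contMDiffAt_nhds (by simp)).1 hX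

lemma RegAt.bracket {k : ℕ} {X Y : VField E M} {x : M} (hX : RegAt (k + 1) X x)
    (hY : RegAt (k + 1) Y x) : RegAt k (bracket X Y) x := by
  have : IsManifold 𝓘(ℝ, E) (((k + 1 : ℕ) : ℕ∞) + 1) M :=
    IsManifold.of_le (n := ∞) (by exact_mod_cast le_top)
  have : IsManifold 𝓘(ℝ, E) (minSmoothness ℝ 2) M := by
    rw [minSmoothness_of_isRCLikeNormedField]; infer_instance
  exact ContMDiffAt.mlieBracket_vectorField (m := (k : ℕ∞)) (n := ((k + 1 : ℕ) : ℕ∞)) hX hY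
    (by simp)

lemma smoothAt_extend {x : M} (v : TangentSpace 𝓘(ℝ, E) x) :
    SmoothAt (FiberBundle.extend E v) x :=
  FiberBundle.contMDiffAt_extend ..

lemma exists_smoothAt_ext (x : M) (v : TangentSpace 𝓘(ℝ, E) x) :
    ∃ X : VField E M, SmoothAt X x ∧ X x = v :=
  ⟨FiberBundle.extend E v, smoothAt_extend v, by simp⟩

lemma jacobi {X Y Z : VField E M} {x : M} (hX : RegAt 2 X x) (hY : RegAt 2 Y x)
    (hZ : RegAt 2 Z x) :
    bracket X (bracket Y Z) x = bracket (bracket X Y) Z x + bracket Y (bracket X Z) x := by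
  have : IsManifold 𝓘(ℝ, E) (minSmoothness ℝ 3) M := by
    rw [minSmoothness_of_isRCLikeNormedField]; infer_instance
  refine VectorField.leibniz_identity_mlieBracket_apply ?_ ?_ ?_ <;>
    rwa [minSmoothness_of_isRCLikeNormedField]

lemma mdifferentiableAt_dirDeriv {X : VField E M} {f : M → ℝ} {x : M} (hX : RegAt 1 X x)
    (hf : ContMDiffAt 𝓘(ℝ, E) 𝓘(ℝ, ℝ) 2 f x) :
    MDifferentiableAt 𝓘(ℝ, E) 𝓘(ℝ, ℝ) (dirDeriv X f) x := by
  have h := ContMDiffAt.mfderiv_const (m := 1) hf (by norm_num)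
  have h2 := ContMDiffAt.clm_apply_of_inCoordinates (b₁ := id) (b₂ := f) h hX
    (hf.of_le (by norm_num))
  rw [Bundle.contMDiffAt_totalSpace] at h2
  have h3 := h2.2.mdifferentiableAt (by simp)
  convert h3 using 2 with y
  simp [dirDeriv, mvfderiv, NormedSpace.fromTangentSpace]
  rfl

lemma bracket_congr {X X' Y Y' : VField E M} {x : M} (hX : X =ᶠ[𝓝 x] X') (hY : Y =ᶠ[𝓝 x] Y') :
    bracket X Y x = bracket X' Y' x :=
  hX.mlieBracket_vectorField_eq hY

lemma bracket_swap (X Y : VField E M) (x : M) : bracket X Y x = - bracket Y X x :=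
  VectorField.mlieBracket_swap_apply

lemma bracket_add_right {X Y Y' : VField E M} {x : M} (hY : DiffAt Y x) (hY' : DiffAt Y' x) :
    bracket X (Y + Y') x = bracket X Y x + bracket X Y' x :=
  VectorField.mlieBracket_add_right hY hY'

lemma bracket_smul_right {X Y : VField E M} {f : M → ℝ} {x : M}
    (hf : MDifferentiableAt 𝓘(ℝ, E) 𝓘(ℝ, ℝ) f x) (hY : DiffAt Y x) :
    bracket X (f • Y) x = dirDeriv X f x • Y x + f x • bracket X Y x :=
  VectorField.mlieBracket_smul_right hf hY

/-- The Lie bracket acts on `C²` functions as the commutator of derivations. -/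
lemma dirDeriv_bracket {X Y : VField E M} {f : M → ℝ} {x : M} (hX : RegAt 2 X x)
    (hY : RegAt 2 Y x) (hf : ContMDiffAt 𝓘(ℝ, E) 𝓘(ℝ, ℝ) 2 f x) :
    dirDeriv (bracket X Y) f x = dirDeriv X (dirDeriv Y f) x - dirDeriv Y (dirDeriv X f) x := by
  -- Compare the coefficients of a nonvanishing field `Z` in the Jacobi identity for `X, Y, f Z`.
  by_cases hE : ∀ v : TangentSpace 𝓘(ℝ, E) x, v = 0
  · simp [dirDeriv, hE (X x), hE (Y x), hE (bracket X Y x)]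
  push Not at hE
  obtain ⟨v, hv⟩ := hE
  obtain ⟨Z, hZs, rfl⟩ := exists_smoothAt_ext x v
  have hZ := hZs.regAt 2
  have hfm := hf.mdifferentiableAt (by simp)
  have hZd : DiffAt Z x := hZs.diffAt
  have key : ∀ {W : VField E M}, RegAt 2 W x →
      bracket W (f • Z) =ᶠ[𝓝 x] dirDeriv W f • Z + f • bracket W Z := by
    intro W hW
    filter_upwards [(contMDiffAt_iff_contMDiffAt_nhds (by simp)).1 hf, hZ.eventually] with y h1 h2
    exact VectorField.mlieBracket_smul_right (h1.mdifferentiableAt (by simp)) h2.diffAt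
  have key2 : ∀ {V W : VField E M}, RegAt 2 V x → RegAt 2 W x →
      bracket V (bracket W (f • Z)) x = dirDeriv V (dirDeriv W f) x • Z x
        + dirDeriv W f x • bracket V Z x
        + (dirDeriv V f x • bracket W Z x + f x • bracket V (bracket W Z) x) := by
    intro V W hV hW
    have hWZ : DiffAt (bracket W Z) x := (RegAt.bracket (k := 1) hW hZ).diffAt
    have hWf : MDifferentiableAt 𝓘(ℝ, E) 𝓘(ℝ, ℝ) (dirDeriv W f) x :=
      mdifferentiableAt_dirDeriv (ContMDiffAt.of_le hW (by norm_num)) hf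
    rw [bracket_congr (X' := V) (Filter.EventuallyEq.refl _ _) (key hW),
      bracket_add_right (hWf.smul_section hZd) (hfm.smul_section hWZ),
      bracket_smul_right hWf hZd, bracket_smul_right hfm hWZ]
  have hfZ : RegAt 2 (f • Z) x := ContMDiffAt.smul_section hf hZ
  have hJ := jacobi hX hY hfZ
  have hXY : DiffAt (bracket X Y) x := (RegAt.bracket (k := 1) hX hY).diffAt
  rw [key2 hX hY, key2 hY hX, bracket_smul_right hfm hZd, jacobi hX hY hZ] at hJ
  have : (dirDeriv (bracket X Y) f x
      - (dirDeriv X (dirDeriv Y f) x - dirDeriv Y (dirDeriv X f) x)) • Z x = 0 := by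
    linear_combination (norm := module) (-1 : ℝ) • hJ
  exact sub_eq_zero.1 ((smul_eq_zero.1 this).resolve_right hv)

lemma jacobi_cyclic {X Y Z : VField E M} {x : M} (hX : RegAt 2 X x) (hY : RegAt 2 Y x)
    (hZ : RegAt 2 Z x) :
    bracket (bracket X Y) Z x + bracket (bracket Y Z) X x + bracket (bracket Z X) Y x = 0 := by
  have hXZ : DiffAt (bracket X Z) x := (RegAt.bracket (k := 1) hX hZ).diffAt
  have h1 : bracket Z X = (-1 : ℝ) • bracket X Z := by
    ext1 y
    rw [bracket_swap]
    simp
  have h2 : bracket ((-1 : ℝ) • bracket X Z) Y x = (-1 : ℝ) • bracket (bracket X Z) Y x :=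
    VectorField.mlieBracket_const_smul_left hXZ
  rw [h1, h2, bracket_swap (bracket X Z) Y, bracket_swap (bracket Y Z) X, jacobi hX hY hZ]
  module

lemma dirDeriv_congr {X : VField E M} {f f' : M → ℝ} {x : M} (h : f =ᶠ[𝓝 x] f') :
    dirDeriv X f x = dirDeriv X f' x := by
  simp only [dirDeriv, mvfderiv, h.mfderiv_eq]
  rfl

lemma dirDeriv_sub {X : VField E M} {f f' : M → ℝ} {x : M}
    (hf : MDifferentiableAt 𝓘(ℝ, E) 𝓘(ℝ, ℝ) f x)
    (hf' : MDifferentiableAt 𝓘(ℝ, E) 𝓘(ℝ, ℝ) f' x) :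
    dirDeriv X (f - f') x = dirDeriv X f x - dirDeriv X f' x := by
  simp [dirDeriv, mvfderiv_sub hf hf']

lemma dirDeriv_const {X : VField E M} {f : M → ℝ} {c : ℝ} (h : ∀ y, f y = c) (x : M) :
    dirDeriv X f x = 0 := by
  obtain rfl : f = fun _ ↦ c := funext h
  simp [dirDeriv, mvfderiv_const]

lemma dirDeriv_const_smul {X : VField E M} {f : M → ℝ} {x : M} (c : ℝ)
    (hf : MDifferentiableAt 𝓘(ℝ, E) 𝓘(ℝ, ℝ) f x) :
    dirDeriv X (c • f) x = c * dirDeriv X f x := by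
  have h : c • f = (fun _ : M ↦ c) • f := rfl
  rw [dirDeriv, h, mvfderiv_smul mdifferentiableAt_const hf]
  simp [mvfderiv_const]

end Calculus

/-! ### The fundamental 2-form and the derivative of the structure tensor -/

variable {n : ℕ} {M : Type v} [TopologicalSpace M] [ChartedSpace (Model n) M]
  [IsManifold 𝓘(ℝ, Model n) ∞ M]

namespace AlmostParacontact

variable (S : AlmostParacontact n M)

lemma regAt_ξ (k : ℕ) (x : M) : RegAt k S.ξ x := SmoothAt.regAt (S.smooth_ξ x) k

lemma diffAt_ξ (x : M) : DiffAt S.ξ x := SmoothAt.diffAt (S.smooth_ξ x)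

lemma regAt_appl {k : ℕ} {X : VField (Model n) M} {x : M} (hX : RegAt k X x) :
    RegAt k (appl S.φ X) x :=
  ContMDiffAt.clm_bundle_apply ((S.smooth_φ x).of_le (by exact_mod_cast le_top)) hX

lemma contMDiffAt_η {k : ℕ} {X : VField (Model n) M} {x : M} (hX : RegAt k X x) :
    ContMDiffAt 𝓘(ℝ, Model n) 𝓘(ℝ, ℝ) k (fun y ↦ S.η y (X y)) x := by
  have h : ContMDiffAt 𝓘(ℝ, Model n) (𝓘(ℝ, Model n).prod 𝓘(ℝ, ℝ)) k
      (fun m ↦ Bundle.TotalSpace.mk' ℝ (E := Bundle.Trivial M ℝ) m (S.η m (X m))) x :=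
    ContMDiffAt.clm_bundle_apply (E₂ := Bundle.Trivial M ℝ)
      ((S.smooth_η x).of_le (by exact_mod_cast le_top)) hX
  rw [Bundle.contMDiffAt_totalSpace] at h
  exact h.2

lemma mdifferentiableAt_η {X : VField (Model n) M} {x : M} (hX : DiffAt X x) :
    MDifferentiableAt 𝓘(ℝ, Model n) 𝓘(ℝ, ℝ) (fun y ↦ S.η y (X y)) x := by
  have h : MDifferentiableAt 𝓘(ℝ, Model n) (𝓘(ℝ, Model n).prod 𝓘(ℝ, ℝ))
      (fun m ↦ Bundle.TotalSpace.mk' ℝ (E := Bundle.Trivial M ℝ) m (S.η m (X m))) x :=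
    MDifferentiableAt.clm_bundle_apply (E₂ := Bundle.Trivial M ℝ)
      ((S.smooth_η x).mdifferentiableAt (by simp)) hX
  rw [mdifferentiableAt_totalSpace] at h
  exact h.2

lemma φ_ξ (x : M) : S.φ x (S.ξ x) = 0 := by
  have h0 : S.φ x (S.φ x (S.ξ x)) = 0 := by simp [S.φ_sq, S.η_ξ]
  have h1 : S.φ x (S.ξ x) = S.η x (S.φ x (S.ξ x)) • S.ξ x := by
    have := S.φ_sq x (S.φ x (S.ξ x))
    rw [h0, map_zero] at this
    exact sub_eq_zero.1 this.symm
  have h2 : S.η x (S.φ x (S.ξ x)) • S.φ x (S.ξ x) = 0 := by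
    rw [← map_smul, ← h1, h0]
  rcases smul_eq_zero.1 h2 with h | h
  · rw [h1, h, zero_smul]
  · exact h

lemma η_φ (x : M) (v : TangentSpace 𝓘(ℝ, Model n) x) : S.η x (S.φ x v) = 0 := by
  have h1 := S.φ_sq x (S.φ x v)
  rw [S.φ_sq x v, map_sub, map_smul, S.φ_ξ, smul_zero, sub_zero] at h1
  have h2 : S.η x (S.φ x v) • S.ξ x = 0 := by
    simpa only [sub_eq_self] using h1.symm
  simpa [S.η_ξ] using congrArg (S.η x) h2

end AlmostParacontact

namespace ParacontactMetric

variable (S : ParacontactMetric n M)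

lemma g_ξ_left (x : M) (v : TangentSpace 𝓘(ℝ, Model n) x) : S.g.val x (S.ξ x) v = S.η x v := by
  have h := S.compatible x (S.ξ x) v
  rw [S.φ_ξ, S.η_ξ] at h
  simp at h
  linarith

lemma g_ξ_right (x : M) (v : TangentSpace 𝓘(ℝ, Model n) x) : S.g.val x v (S.ξ x) = S.η x v := by
  rw [S.g.symm, S.g_ξ_left]

lemma g_φ_left (x : M) (v w : TangentSpace 𝓘(ℝ, Model n) x) :
    S.g.val x (S.φ x v) w = - S.g.val x v (S.φ x w) := by
  have h := S.compatible x v (S.φ x w)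
  rw [S.φ_sq, S.η_φ] at h
  simp [S.g_ξ_right, S.η_φ] at h
  exact h

/-- The Levi-Civita covariant derivative `∇_v X` of a vector field in the direction of a tangent
vector. -/
abbrev nabla (X : VField (Model n) M) (x : M) (v : TangentSpace 𝓘(ℝ, Model n) x) :
    TangentSpace 𝓘(ℝ, Model n) x := S.g.leviCivita X x v

lemma bracket_eq {X Y : VField (Model n) M} {x : M} (hX : DiffAt X x) (hY : DiffAt Y x) :
    bracket X Y x = S.nabla Y x (X x) - S.nabla X x (Y x) :=
  ((S.g.leviCivita.torsion_eq_zero_iff).1 S.g.leviCivita_torsion hX hY).symm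

/-- The contact condition says that the skew part of `v ↦ ∇_v ξ` is `-φ`. -/
lemma nabla_ξ_sub (x : M) (v w : TangentSpace 𝓘(ℝ, Model n) x) :
    S.g.val x (S.nabla S.ξ x v) w - S.g.val x v (S.nabla S.ξ x w) = 2 * S.g.val x v (S.φ x w) := by
  obtain ⟨X, hX, rfl⟩ := exists_smoothAt_ext x v
  obtain ⟨Y, hY, rfl⟩ := exists_smoothAt_ext x w
  have hXd := SmoothAt.diffAt hX
  have hYd := SmoothAt.diffAt hY
  have h := S.d_η x X Y hX hY
  have e : ∀ Z : VField (Model n) M, (fun y ↦ S.η y (Z y)) = S.g.pair S.ξ Z := fun Z ↦ by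
    ext y; exact (S.g_ξ_left y _).symm
  rw [extDeriv, e, e, S.g.leviCivita_metric hXd (S.diffAt_ξ x) hYd,
    S.g.leviCivita_metric hYd (S.diffAt_ξ x) hXd, ← S.g_ξ_left, S.bracket_eq hXd hYd] at h
  rw [map_sub] at h
  rw [S.g.symm x (X x) (S.nabla _ _ _)]
  simp only [nabla] at h ⊢
  linarith

/-- `dη(X, Y) = g(X, φ Y)` holds for vector fields which are merely differentiable. -/
lemma extDeriv_η {X Y : VField (Model n) M} {x : M} (hX : DiffAt X x) (hY : DiffAt Y x) :
    extDeriv S.η X Y x = S.g.val x (X x) (S.φ x (Y x)) := by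
  have h := S.nabla_ξ_sub x (X x) (Y x)
  have e : ∀ Z : VField (Model n) M, (fun y ↦ S.η y (Z y)) = S.g.pair S.ξ Z := fun Z ↦ by
    ext y; exact (S.g_ξ_left y _).symm
  rw [extDeriv, e, e, S.g.leviCivita_metric hX (S.diffAt_ξ x) hY,
    S.g.leviCivita_metric hY (S.diffAt_ξ x) hX, ← S.g_ξ_left, S.bracket_eq hX hY, map_sub]
  rw [S.g.symm x (X x) (S.nabla _ _ _)] at h
  simp only [nabla] at h ⊢
  linarith

/-- The derivative `(∇_v φ) Y = ∇_v (φ Y) - φ ∇_v Y` of the structure tensor `φ`. It is tensorial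
in `Y`, but is kept as a function of the vector field. -/
def nablaφ (Y : VField (Model n) M) (x : M) (v : TangentSpace 𝓘(ℝ, Model n) x) :
    TangentSpace 𝓘(ℝ, Model n) x :=
  S.nabla (appl S.φ Y) x v - S.φ x (S.nabla Y x v)

lemma nabla_appl (Y : VField (Model n) M) (x : M) (v : TangentSpace 𝓘(ℝ, Model n) x) :
    S.nabla (appl S.φ Y) x v = S.nablaφ Y x v + S.φ x (S.nabla Y x v) := by
  simp [nablaφ]

/-- `∇_X ξ` is orthogonal to `ξ`, since `ξ` has constant length. -/
lemma η_nabla_ξ (x : M) (v : TangentSpace 𝓘(ℝ, Model n) x) : S.η x (S.nabla S.ξ x v) = 0 := by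
  obtain ⟨X, hX, rfl⟩ := exists_smoothAt_ext x v
  have h := S.g.leviCivita_metric (SmoothAt.diffAt hX) (S.diffAt_ξ x) (S.diffAt_ξ x)
  rw [dirDeriv_const (c := 1) (fun y ↦ by simp [SemiRiemannianMetric.pair, g_ξ_left, S.η_ξ]),
    S.g_ξ_left, S.g_ξ_right] at h
  simp only [nabla]
  linarith

/-- The integral curves of `ξ` are geodesics. -/
lemma nabla_ξ_ξ (x : M) : S.nabla S.ξ x (S.ξ x) = 0 := by
  refine S.g.nondegenerate x _ fun w ↦ ?_
  have h := S.nabla_ξ_sub x (S.ξ x) w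
  rw [S.g_ξ_left, S.g_ξ_left, S.η_nabla_ξ, S.η_φ] at h
  linarith

lemma g_nablaφ_skew {Y Z : VField (Model n) M} {x : M} (hY : DiffAt Y x) (hZ : DiffAt Z x)
    (v : TangentSpace 𝓘(ℝ, Model n) x) :
    S.g.val x (S.nablaφ Y x v) (Z x) = - S.g.val x (Y x) (S.nablaφ Z x v) := by
  obtain ⟨X, hX, rfl⟩ := exists_smoothAt_ext x v
  have h1 := S.g.leviCivita_metric (SmoothAt.diffAt hX) (S.diffAt_appl hY) hZ
  have h2 := S.g.leviCivita_metric (SmoothAt.diffAt hX) hY (S.diffAt_appl hZ)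
  have e : S.g.pair (appl S.φ Y) Z = - S.g.pair Y (appl S.φ Z) := by
    ext y; exact S.g_φ_left y _ _
  rw [e, dirDeriv, mvfderiv_neg] at h1
  have h3 := S.g_φ_left x (S.nabla Y x (X x)) (Z x)
  have h4 := S.g_φ_left x (Y x) (S.nabla Z x (X x))
  simp only [nablaφ, map_sub, sub_apply, neg_apply, nabla, dirDeriv] at *
  linarith

/-- The fundamental 2-form `g(X, φ Y) = dη(X, Y)` is closed; its exterior derivative is written
here through the Levi-Civita connection. -/
lemma g_nablaφ_cyclic {X Y Z : VField (Model n) M} {x : M} (hX : RegAt 2 X x) (hY : RegAt 2 Y x)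
    (hZ : RegAt 2 Z x) :
    S.g.val x (S.nablaφ Y x (X x)) (Z x) + S.g.val x (S.nablaφ Z x (Y x)) (X x)
      + S.g.val x (S.nablaφ X x (Z x)) (Y x) = 0 := by
  -- `2 X (dη(Y, Z))`, computed both with the connection and from the definition of `dη`
  have key : ∀ {X Y Z : VField (Model n) M}, RegAt 2 X x → RegAt 2 Y x → RegAt 2 Z x →
      2 * (S.g.val x (S.nabla Y x (X x)) (S.φ x (Z x)) + S.g.val x (Y x) (S.nablaφ Z x (X x))
        - S.g.val x (S.φ x (Y x)) (S.nabla Z x (X x))) =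
      dirDeriv X (dirDeriv Y (fun y ↦ S.η y (Z y))) x
        - dirDeriv X (dirDeriv Z (fun y ↦ S.η y (Y y))) x
        - dirDeriv X (fun y ↦ S.η y (bracket Y Z y)) x := by
    intro X Y Z hX hY hZ
    have hXd := RegAt.diffAt (k := 1) hX
    have hYd := RegAt.diffAt (k := 1) hY
    have hZd := RegAt.diffAt (k := 1) hZ
    have hY1 : RegAt 1 Y x := ContMDiffAt.of_le hY (by norm_num)
    have hZ1 : RegAt 1 Z x := ContMDiffAt.of_le hZ (by norm_num)
    have hYZ := RegAt.bracket (k := 1) hY hZ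
    have d1 := mdifferentiableAt_dirDeriv hY1 (S.contMDiffAt_η hZ)
    have d2 := mdifferentiableAt_dirDeriv hZ1 (S.contMDiffAt_η hY)
    have d3 := S.mdifferentiableAt_η (RegAt.diffAt (k := 0) hYZ)
    have e : (2 : ℝ) • S.g.pair Y (appl S.φ Z) =ᶠ[𝓝 x]
        (dirDeriv Y (fun y ↦ S.η y (Z y)) - dirDeriv Z (fun y ↦ S.η y (Y y)))
          - fun y ↦ S.η y (bracket Y Z y) := by
      filter_upwards [RegAt.eventually hY, RegAt.eventually hZ] with y h1 h2
      have := S.extDeriv_η (RegAt.diffAt (k := 1) h1) (RegAt.diffAt (k := 1) h2)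
      simp only [extDeriv] at this
      simp only [SemiRiemannianMetric.pair, appl, Pi.smul_apply, Pi.sub_apply, ← this, smul_eq_mul]
      ring
    have h := S.g.leviCivita_metric hXd hYd (S.diffAt_appl hZd)
    have h' := dirDeriv_congr (X := X) e
    rw [dirDeriv_const_smul _ (S.g.mdifferentiableAt_pair hYd (S.diffAt_appl hZd)),
      dirDeriv_sub (d1.sub d2) d3, dirDeriv_sub d1 d2, h] at h'
    rw [← h']
    have h3 := S.g_φ_left x (Y x) (S.nabla Z x (X x))
    simp only [nablaφ, map_sub, nabla, appl] at h3 ⊢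
    linarith
  -- the same for `2 dη([X, Y], Z)`
  have key2 : ∀ {X Y Z : VField (Model n) M}, RegAt 2 X x → RegAt 2 Y x → RegAt 2 Z x →
      2 * (S.g.val x (S.nabla Y x (X x)) (S.φ x (Z x))
        - S.g.val x (S.nabla X x (Y x)) (S.φ x (Z x))) =
      dirDeriv X (dirDeriv Y (fun y ↦ S.η y (Z y))) x
        - dirDeriv Y (dirDeriv X (fun y ↦ S.η y (Z y))) x
        - dirDeriv Z (fun y ↦ S.η y (bracket X Y y)) x - S.η x (bracket (bracket X Y) Z x) := by
    intro X Y Z hX hY hZ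
    have h := S.extDeriv_η (RegAt.diffAt (k := 0) (RegAt.bracket (k := 1) hX hY))
      (RegAt.diffAt (k := 1) hZ)
    rw [extDeriv, dirDeriv_bracket hX hY (S.contMDiffAt_η hZ),
      S.bracket_eq (RegAt.diffAt (k := 1) hX) (RegAt.diffAt (k := 1) hY), map_sub, sub_apply] at h
    linarith
  -- in the cyclic sum the second derivatives cancel, and so do the brackets by Jacobi
  have hJ := congrArg (S.η x) (jacobi_cyclic hX hY hZ)
  simp only [map_add, map_zero] at hJ
  have a1 := key hX hY hZ
  have a2 := key hY hZ hX
  have a3 := key hZ hX hY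
  have b1 := key2 hX hY hZ
  have b2 := key2 hY hZ hX
  have b3 := key2 hZ hX hY
  have hXd := RegAt.diffAt (k := 1) hX
  have hYd := RegAt.diffAt (k := 1) hY
  have hZd := RegAt.diffAt (k := 1) hZ
  rw [S.g_nablaφ_skew hYd hZd, S.g_nablaφ_skew hZd hXd, S.g_nablaφ_skew hXd hYd]
  rw [S.g.symm x (S.φ x _)] at a1 a2 a3
  linarith

/-! ### The Reeb field, the operator `h`, and the curvature identity -/

lemma nabla_add {X Y : VField (Model n) M} {x : M} (hX : DiffAt X x) (hY : DiffAt Y x)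
    (v : TangentSpace 𝓘(ℝ, Model n) x) :
    S.nabla (X + Y) x v = S.nabla X x v + S.nabla Y x v := by
  simp [nabla, S.g.leviCivita.isCovariantDerivativeOn (s := Set.univ).add hX hY]

lemma nabla_smul {f : M → ℝ} {X : VField (Model n) M} {x : M}
    (hf : MDifferentiableAt 𝓘(ℝ, Model n) 𝓘(ℝ, ℝ) f x) (hX : DiffAt X x)
    (v : TangentSpace 𝓘(ℝ, Model n) x) :
    S.nabla (f • X) x v = f x • S.nabla X x v + mvfderiv 𝓘(ℝ, Model n) f x v • X x := by
  simp [nabla, S.g.leviCivita.isCovariantDerivativeOn (s := Set.univ).leibniz hX hf]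

lemma nabla_neg {X : VField (Model n) M} {x : M} (hX : DiffAt X x)
    (v : TangentSpace 𝓘(ℝ, Model n) x) :
    S.nabla (-X) x v = - S.nabla X x v := by
  have e : -X = (-1 : ℝ) • X := by simp
  rw [nabla, nabla, e, S.g.leviCivita.isCovariantDerivativeOn (s := Set.univ).smul_const (-1) hX]
  simp

lemma nabla_zero (x : M) (v : TangentSpace 𝓘(ℝ, Model n) x) :
    S.nabla (0 : VField (Model n) M) x v = 0 := by
  simp [nabla, CovariantDerivative.zero]

lemma φ_cube (x : M) (v : TangentSpace 𝓘(ℝ, Model n) x) :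
    S.φ x (S.φ x (S.φ x v)) = S.φ x v := by
  rw [S.φ_sq x (S.φ x v), S.η_φ, zero_smul, sub_zero]

lemma nablaφ_ξ (x : M) (v : TangentSpace 𝓘(ℝ, Model n) x) :
    S.nablaφ S.ξ x v = - S.φ x (S.nabla S.ξ x v) := by
  have e : appl S.φ S.ξ = 0 := by ext1 y; exact S.φ_ξ y
  rw [nablaφ, e, S.nabla_zero, zero_sub]

/-- Closedness of `dη` with one argument equal to `ξ`. -/
lemma nablaφ_along_ξ_eq {Y : VField (Model n) M} {x : M} (hY : RegAt 2 Y x) :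
    S.nablaφ Y x (S.ξ x) = - S.φ x (S.nabla S.ξ x (Y x)) - S.nabla S.ξ x (S.φ x (Y x))
      - (2 : ℝ) • S.φ x (S.φ x (Y x)) := by
  rw [← sub_eq_zero]
  refine S.g.nondegenerate x _ fun w ↦ ?_
  obtain ⟨Z, hZ, rfl⟩ := exists_smoothAt_ext x w
  have h := S.g_nablaφ_cyclic (S.regAt_ξ 2 x) hY (SmoothAt.regAt hZ 2)
  rw [S.g_nablaφ_skew (SmoothAt.diffAt hZ) (S.diffAt_ξ x), S.nablaφ_ξ, S.nablaφ_ξ] at h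
  have h2 := S.nabla_ξ_sub x (Z x) (S.φ x (Y x))
  have h3 := S.g_φ_left x (S.nabla S.ξ x (Z x)) (Y x)
  simp only [map_neg, neg_apply, map_sub, sub_apply, map_smul, smul_apply, smul_eq_mul] at h h2 h3 ⊢
  rw [S.g.symm x _ (Z x), S.g.symm x (S.φ x _) (Z x), S.g.symm x (S.nabla S.ξ x _) (Z x),
    S.g.symm x (S.φ x _) (Z x)]
  rw [S.g.symm x _ (Z x)] at h
  linarith

/-- The structure tensor is parallel along the Reeb field: `∇_ξ φ = 0`. -/
lemma nablaφ_along_ξ {Y : VField (Model n) M} {x : M} (hY : RegAt 2 Y x) :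
    S.nablaφ Y x (S.ξ x) = 0 := by
  have h1 := S.nablaφ_along_ξ_eq hY
  have h2 := S.nablaφ_along_ξ_eq (S.regAt_appl hY)
  have hYd := RegAt.diffAt (k := 1) hY
  have hA : S.nabla S.ξ x (S.φ x (S.φ x (Y x))) = S.nabla S.ξ x (Y x) := by
    rw [S.φ_sq, nabla, map_sub, map_smul]
    simp [show S.g.leviCivita S.ξ x (S.ξ x) = 0 from S.nabla_ξ_ξ x]
  have hA' : S.φ x (S.φ x (S.nabla S.ξ x (Y x))) = S.nabla S.ξ x (Y x) := by
    rw [S.φ_sq, S.η_nabla_ξ, zero_smul, sub_zero]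
  have hη : S.η x (S.nablaφ Y x (S.ξ x)) = 0 := by
    rw [h1]
    simp [S.η_φ, S.η_nabla_ξ]
  -- the formula for `∇_ξ φ` shows that it commutes with `φ`
  have hcomm : S.nablaφ (appl S.φ Y) x (S.ξ x) = S.φ x (S.nablaφ Y x (S.ξ x)) := by
    rw [h1, h2]
    simp only [appl, map_sub, map_neg, map_smul, hA, hA']
    abel
  -- differentiating `φ² = 1 - η ⊗ ξ` along `ξ` shows that it anticommutes with `φ`
  have hanti : S.nablaφ (appl S.φ Y) x (S.ξ x) = - S.φ x (S.nablaφ Y x (S.ξ x)) := by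
    have e : appl S.φ (appl S.φ Y) = Y + -((fun y ↦ S.η y (Y y)) • S.ξ) := by
      ext1 y
      simp [appl, S.φ_sq, sub_eq_add_neg]
    have hf := S.mdifferentiableAt_η hYd
    have hd : DiffAt ((fun y ↦ S.η y (Y y)) • S.ξ) x := hf.smul_section (S.diffAt_ξ x)
    have hd' : DiffAt (-((fun y ↦ S.η y (Y y)) • S.ξ)) x := mdifferentiableAt_neg_section hd
    have hm := S.g.leviCivita_metric (S.diffAt_ξ x) (S.diffAt_ξ x) hYd
    have e' : S.g.pair S.ξ Y = (fun y ↦ S.η y (Y y)) := by ext y; exact S.g_ξ_left y _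
    rw [e', show S.g.leviCivita S.ξ x (S.ξ x) = 0 from S.nabla_ξ_ξ x, S.g_ξ_left] at hm
    simp only [dirDeriv] at hm
    rw [nablaφ, e, S.nabla_add hYd hd', S.nabla_neg hd, S.nabla_smul hf (S.diffAt_ξ x), hm,
      S.nabla_ξ_ξ, S.nabla_appl, map_add, S.φ_sq x (S.nabla Y x _)]
    simp only [map_zero, zero_apply, zero_add, smul_zero]
    module
  have h0 : S.φ x (S.nablaφ Y x (S.ξ x)) = 0 := by
    rw [hcomm] at hanti
    have h2 : (2 : ℝ) • S.φ x (S.nablaφ Y x (S.ξ x)) = 0 := by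
      linear_combination (norm := module) hanti
    exact (smul_eq_zero.1 h2).resolve_left two_ne_zero
  have := S.φ_sq x (S.nablaφ Y x (S.ξ x))
  rw [h0, map_zero, hη, zero_smul, sub_zero] at this
  exact this.symm

lemma nabla_ξ_φ (x : M) (v : TangentSpace 𝓘(ℝ, Model n) x) :
    S.nabla S.ξ x (S.φ x v) = - S.φ x (S.nabla S.ξ x v) - (2 : ℝ) • S.φ x (S.φ x v) := by
  obtain ⟨X, hX, rfl⟩ := exists_smoothAt_ext x v
  have h := S.nablaφ_along_ξ_eq (SmoothAt.regAt hX 2)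
  rw [S.nablaφ_along_ξ (SmoothAt.regAt hX 2)] at h
  linear_combination (norm := module) h

lemma h_eq (x : M) (v : TangentSpace 𝓘(ℝ, Model n) x) :
    S.h x v = S.φ x (S.nabla S.ξ x v) + S.φ x (S.φ x v) := by
  obtain ⟨X, hX, rfl⟩ := exists_smoothAt_ext x v
  have hXd := SmoothAt.diffAt hX
  rw [S.h_apply hXd, lieDeriv, S.bracket_eq (S.diffAt_ξ x) (S.diffAt_appl hXd),
    S.bracket_eq (S.diffAt_ξ x) hXd, S.nabla_appl, S.nablaφ_along_ξ (SmoothAt.regAt hX 2),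
    S.nabla_ξ_φ, map_sub]
  module

/-- The covariant derivative of the Reeb field: `∇_X ξ = - φ X + φ h X`. -/
lemma nabla_ξ_eq (x : M) (v : TangentSpace 𝓘(ℝ, Model n) x) :
    S.nabla S.ξ x v = - S.φ x v + S.φ x (S.h x v) := by
  rw [S.h_eq, map_add, S.φ_cube, S.φ_sq, S.η_nabla_ξ]
  module

lemma h_ξ (x : M) : S.h x (S.ξ x) = 0 := by
  simp [S.h_eq, S.nabla_ξ_ξ, S.φ_ξ]

lemma η_h (x : M) (v : TangentSpace 𝓘(ℝ, Model n) x) : S.η x (S.h x v) = 0 := by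
  simp [S.h_eq, S.η_φ]

/-- `h` anticommutes with `φ`. -/
lemma h_φ (x : M) (v : TangentSpace 𝓘(ℝ, Model n) x) : S.h x (S.φ x v) = - S.φ x (S.h x v) := by
  simp only [S.h_eq, S.nabla_ξ_φ, map_add, map_sub, map_neg, map_smul]
  rw [S.φ_cube]
  module

/-- `h` is self-adjoint. -/
lemma h_symm (x : M) (v w : TangentSpace 𝓘(ℝ, Model n) x) :
    S.g.val x (S.h x v) w = S.g.val x v (S.h x w) := by
  have h1 := S.nabla_ξ_sub x v (S.φ x w)
  rw [S.nabla_ξ_φ] at h1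
  rw [S.h_eq, S.h_eq]
  simp only [map_add, add_apply, S.g_φ_left, map_sub, map_neg, map_smul, smul_eq_mul] at h1 ⊢
  linarith

/-- Since `h` is expressed by Lie brackets, it preserves regularity up to one derivative. This
avoids any discussion of the regularity of the Levi-Civita connection. -/
lemma regAt_appl_h {X : VField (Model n) M} {x : M} (hX : RegAt 3 X x) :
    RegAt 2 (appl S.h X) x := by
  have h1 : RegAt 2 (bracket S.ξ (appl S.φ X)) x :=
    RegAt.bracket (k := 2) (S.regAt_ξ 3 x) (S.regAt_appl hX)
  have h2 : RegAt 2 (appl S.φ (bracket S.ξ X)) x :=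
    S.regAt_appl (RegAt.bracket (k := 2) (S.regAt_ξ 3 x) hX)
  have h3 : RegAt 2 ((1 / 2 : ℝ) • (bracket S.ξ (appl S.φ X) - appl S.φ (bracket S.ξ X))) x :=
    ContMDiffAt.const_smul_section (ContMDiffAt.sub_section h1 h2)
  refine ContMDiffAt.congr_of_eventuallyEq h3 ?_
  filter_upwards [RegAt.eventually hX] with y hy
  have := S.h_apply (RegAt.diffAt (k := 2) hy)
  simp [appl, this, lieDeriv]

/-- On a paracontact metric `(-1, μ)`-space, `h² = 0`: in the curvature condition for `R(ξ, X) ξ`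
this is the only term besides `φ²` that commutes with `φ`, and the `φ²` terms agree. -/
lemma h_h {μ : ℝ} (hS : S.IsKappaMuSpace (-1) μ) (x : M) (v : TangentSpace 𝓘(ℝ, Model n) x) :
    S.h x (S.h x v) = 0 := by
  have hsq : ∀ w, S.φ x (S.φ x (S.h x w)) = S.h x w := fun w ↦ by
    rw [S.φ_sq, S.η_h, zero_smul, sub_zero]
  -- the curvature condition for `R(ξ, X) ξ`, with `∇ξ` replaced by `-φ + φ h`
  have key : ∀ X : VField (Model n) M, SmoothAt X x →
      S.φ x (S.nabla (appl S.h X) x (S.ξ x) - S.h x (S.nabla X x (S.ξ x)))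
        - S.h x (S.h x (X x)) = - μ • S.h x (X x) := by
    intro X hX
    have hXd := SmoothAt.diffAt hX
    have hH := S.regAt_appl_h (SmoothAt.regAt hX 3)
    have hHd := RegAt.diffAt (k := 1) hH
    have hR := hS x S.ξ X (S.smooth_ξ x) hX
    have e1 : (fun y ↦ S.g.leviCivita S.ξ y (X y)) = -appl S.φ X + appl S.φ (appl S.h X) := by
      ext1 y; exact S.nabla_ξ_eq y _
    have e2 : (fun y ↦ S.g.leviCivita S.ξ y (S.ξ y)) = 0 := by
      ext1 y; exact S.nabla_ξ_ξ y
    have hφd := S.diffAt_appl hXd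
    have hφd' : DiffAt (-appl S.φ X) x := mdifferentiableAt_neg_section hφd
    have t1 : S.nabla (-appl S.φ X + appl S.φ (appl S.h X)) x (S.ξ x) =
        - S.φ x (S.nabla X x (S.ξ x)) + S.φ x (S.nabla (appl S.h X) x (S.ξ x)) := by
      rw [S.nabla_add hφd' (S.diffAt_appl hHd), S.nabla_neg hφd, S.nabla_appl, S.nabla_appl,
        S.nablaφ_along_ξ (SmoothAt.regAt hX 2), S.nablaφ_along_ξ hH]
      module
    have t2 : S.nabla S.ξ x (bracket S.ξ X x) = - S.φ x (S.nabla X x (S.ξ x))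
        + S.φ x (S.h x (S.nabla X x (S.ξ x))) - S.φ x (S.φ x (X x))
        + S.h x (S.h x (X x)) := by
      rw [S.nabla_ξ_eq, S.bracket_eq (S.diffAt_ξ x) hXd, S.nabla_ξ_eq x (X x)]
      simp only [map_sub, map_add, map_neg, S.h_φ, hsq]
      module
    rw [SemiRiemannianMetric.curvature, e1, e2] at hR
    change S.nabla _ x (S.ξ x) - S.nabla 0 x (X x) - S.nabla S.ξ x _ = _ at hR
    rw [t1, t2, S.nabla_zero, S.h_ξ, S.η_ξ, S.φ_sq] at hR
    rw [map_sub]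
    linear_combination (norm := module) hR
  obtain ⟨X, hX, rfl⟩ := exists_smoothAt_ext x v
  have hXd := SmoothAt.diffAt hX
  have hφX : SmoothAt (appl S.φ X) x := ContMDiffAt.clm_bundle_apply (S.smooth_φ x) hX
  have hHd := RegAt.diffAt (k := 1) (S.regAt_appl_h (SmoothAt.regAt hX 3))
  have k1 := key X hX
  have k2 := key _ hφX
  have e : appl S.h (appl S.φ X) = - appl S.φ (appl S.h X) := by
    ext1 y; exact S.h_φ y _
  rw [e, S.nabla_neg (S.diffAt_appl hHd), S.nabla_appl, S.nabla_appl,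
    S.nablaφ_along_ξ (SmoothAt.regAt hX 2),
    S.nablaφ_along_ξ (S.regAt_appl_h (SmoothAt.regAt hX 3))] at k2
  -- compare the condition at `φ X` with `φ` applied to the condition at `X`
  have k3 := congrArg (S.φ x) k1
  simp only [appl, zero_add, map_sub, map_neg, map_smul, S.h_φ, neg_neg] at k2 k3
  have k4 : (2 : ℝ) • S.φ x (S.h x (S.h x (X x))) = 0 := by
    linear_combination (norm := module) (-1 : ℝ) • k2 - k3
  have k5 := congrArg (S.φ x) ((smul_eq_zero.1 k4).resolve_left two_ne_zero)
  rwa [hsq, map_zero] at k5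

/-! ### Normality when `h` vanishes -/

/-- If `h = 0`, the curvature condition determines the skew part of `(X, Y) ↦ (∇_X φ) Y`. -/
lemma nablaφ_sub_nablaφ {μ : ℝ} (hS : S.IsKappaMuSpace (-1) μ) (h0 : ∀ p, S.h p = 0)
    {X Y : VField (Model n) M} {x : M} (hX : SmoothAt X x) (hY : SmoothAt Y x) :
    S.nablaφ Y x (X x) - S.nablaφ X x (Y x) = S.η x (Y x) • X x - S.η x (X x) • Y x := by
  have hXd := SmoothAt.diffAt hX
  have hYd := SmoothAt.diffAt hY
  have hξ : ∀ y v, S.nabla S.ξ y v = - S.φ y v := fun y v ↦ by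
    rw [S.nabla_ξ_eq, h0]; simp
  have e : ∀ Z : VField (Model n) M, (fun y ↦ S.g.leviCivita S.ξ y (Z y)) = -appl S.φ Z :=
    fun Z ↦ by ext1 y; exact hξ y _
  have hR := hS x X Y hX hY
  rw [SemiRiemannianMetric.curvature, e, e, h0] at hR
  change S.nabla _ x (X x) - S.nabla _ x (Y x) - S.nabla S.ξ x _ = _ at hR
  rw [S.nabla_neg (S.diffAt_appl hXd), S.nabla_neg (S.diffAt_appl hYd), S.nabla_appl, S.nabla_appl,
    hξ, S.bracket_eq hXd hYd, map_sub] at hR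
  simp only [zero_apply, smul_zero, sub_zero, add_zero] at hR
  linear_combination (norm := module) (-1 : ℝ) • hR

/-- The covariant derivative of `φ` when `h = 0`. Closedness of `dη` recovers the tensor
`g((∇_Z φ) X, Y)` from its skew part in the other two arguments. -/
lemma nablaφ_eq {μ : ℝ} (hS : S.IsKappaMuSpace (-1) μ) (h0 : ∀ p, S.h p = 0)
    {X : VField (Model n) M} {x : M} (hX : SmoothAt X x) (v : TangentSpace 𝓘(ℝ, Model n) x) :
    S.nablaφ X x v = S.η x (X x) • v - S.g.val x (X x) v • S.ξ x := by
  obtain ⟨Z, hZ, rfl⟩ := exists_smoothAt_ext x v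
  rw [← sub_eq_zero]
  refine S.g.nondegenerate x _ fun w ↦ ?_
  obtain ⟨Y, hY, rfl⟩ := exists_smoothAt_ext x w
  have h1 := S.g_nablaφ_cyclic (SmoothAt.regAt hX 2) (SmoothAt.regAt hY 2) (SmoothAt.regAt hZ 2)
  have h2 := congrArg (fun u ↦ S.g.val x u (Z x)) (S.nablaφ_sub_nablaφ hS h0 hX hY)
  rw [S.g_nablaφ_skew (SmoothAt.diffAt hZ) (SmoothAt.diffAt hX),
    S.g.symm x (Z x) (S.nablaφ X x (Y x))] at h1
  simp only [map_sub, sub_apply, map_smul, smul_apply, smul_eq_mul, S.g_ξ_left] at h2 ⊢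
  rw [S.g.symm x (Z x) (Y x)]
  linarith

lemma isParaSasakian {μ : ℝ} (hS : S.IsKappaMuSpace (-1) μ) (h0 : ∀ p, S.h p = 0) :
    S.IsParaSasakian := by
  intro x X Y hX hY
  have hXd := SmoothAt.diffAt hX
  have hYd := SmoothAt.diffAt hY
  have hφX := S.diffAt_appl hXd
  have hφY := S.diffAt_appl hYd
  rw [nijenhuis, S.extDeriv_η hXd hYd, S.bracket_eq hφX hφY, S.bracket_eq hφX hYd,
    S.bracket_eq hXd hφY, S.bracket_eq hXd hYd]
  simp only [S.nabla_appl, S.nablaφ_eq hS h0 hX, S.nablaφ_eq hS h0 hY, appl, map_sub, map_add,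
    map_smul, S.φ_ξ, S.g.symm x (Y x) (S.φ x (X x)), S.g_φ_left]
  module

/-! ### Hyperbolic pairs adapted to `φ` and `h` -/

variable {p : M}

/-- The eigenspaces of `φ` for `±1` are totally isotropic. -/
lemma g_eq_zero_of_eigen {c : ℝ} (hc : c * c = 1) {v w : TangentSpace 𝓘(ℝ, Model n) p}
    (hv : S.φ p v = c • v) (hw : S.φ p w = c • w) : S.g.val p v w = 0 := by
  have h := S.g_φ_left p v w
  rw [hv, hw] at h
  simp only [map_smul, smul_apply, smul_eq_mul] at h
  have : c * c * S.g.val p v w = 0 := by linear_combination c / 2 * h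
  simpa [hc] using this

/-- For `c = ±1`, `(v + c φ v) / 2` is the projection of a horizontal vector `v` to the
`c`-eigenspace of `φ`. -/
lemma φ_half {c : ℝ} (hc : c * c = 1) {v : TangentSpace 𝓘(ℝ, Model n) p} (hv : S.η p v = 0) :
    S.φ p ((1 / 2 : ℝ) • (v + c • S.φ p v)) = c • ((1 / 2 : ℝ) • (v + c • S.φ p v)) := by
  have h2 : S.φ p (S.φ p v) = v := by rw [S.φ_sq, hv, zero_smul, sub_zero]
  rw [map_smul, map_add, map_smul, h2]
  have h3 : c • c • S.φ p v = S.φ p v := by rw [smul_smul, hc, one_smul]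
  linear_combination (norm := module) (-1 / 2 : ℝ) • h3

lemma φ_h_eigen {c : ℝ} {v : TangentSpace 𝓘(ℝ, Model n) p} (hv : S.φ p v = c • v) :
    S.φ p (S.h p v) = (-c) • S.h p v := by
  have := S.h_φ p v
  rw [hv, map_smul] at this
  rw [neg_smul, this, neg_neg]

/-- A nonzero horizontal subspace which is invariant under `φ` and `h` and on which `g` is
nondegenerate contains a hyperbolic pair of the required form, made of eigenvectors of `φ`. -/
lemma exists_hyperbolic_pair (hh : ∀ v, S.h p (S.h p v) = 0)
    (U : Submodule ℝ (TangentSpace 𝓘(ℝ, Model n) p)) (hη : ∀ v ∈ U, S.η p v = 0)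
    (hφ : ∀ v ∈ U, S.φ p v ∈ U) (hhU : ∀ v ∈ U, S.h p v ∈ U)
    (hnd : ∀ v ∈ U, (∀ w ∈ U, S.g.val p v w = 0) → v = 0) (hU : ∃ v ∈ U, v ≠ 0) :
    ∃ x ∈ U, ∃ y ∈ U, ∃ c ε : ℝ, c * c = 1 ∧ (ε = 1 ∨ ε = -1) ∧ S.φ p x = c • x ∧
      S.φ p y = (-c) • y ∧ S.g.val p x y = ε ∧
      ((S.h p x = y ∧ S.h p y = 0) ∨ (S.h p x = 0 ∧ S.h p y = 0)) := by
  have hhalf : ∀ (c : ℝ), ∀ v ∈ U, (1 / 2 : ℝ) • (v + c • S.φ p v) ∈ U := fun c v hv ↦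
    U.smul_mem _ (U.add_mem hv (U.smul_mem _ (hφ v hv)))
  have hsplit : ∀ (c : ℝ) (v : TangentSpace 𝓘(ℝ, Model n) p),
      v = (1 / 2 : ℝ) • (v + c • S.φ p v) + (1 / 2 : ℝ) • (v + (-c) • S.φ p v) := fun c v ↦ by
    module
  by_cases H : ∃ e ∈ U, ∃ c : ℝ, c * c = 1 ∧ S.φ p e = c • e ∧ S.g.val p (S.h p e) e ≠ 0
  · obtain ⟨e, he, c, hc, hce, hne⟩ := H
    set a := S.g.val p (S.h p e) e with ha
    have hs : 0 < √|a| := Real.sqrt_pos.2 (abs_pos.2 hne)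
    have hs2 : √|a| * √|a| = |a| := Real.mul_self_sqrt (abs_nonneg a)
    have hφx : S.φ p ((√|a|)⁻¹ • e) = c • ((√|a|)⁻¹ • e) := by
      rw [map_smul, hce, smul_comm]
    refine ⟨(√|a|)⁻¹ • e, U.smul_mem _ he, S.h p ((√|a|)⁻¹ • e), hhU _ (U.smul_mem _ he), c,
      a / |a|, hc, ?_, hφx, S.φ_h_eigen hφx, ?_, Or.inl ⟨rfl, hh _⟩⟩
    · rcases lt_or_gt_of_ne hne with h | h
      · right; rw [abs_of_neg h]; field_simp
      · left; rw [abs_of_pos h]; field_simp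
    · rw [S.g.symm]
      simp only [map_smul, smul_apply, smul_eq_mul, ← ha]
      rw [← mul_assoc, ← mul_inv, hs2]
      field_simp
  · push Not at H
    -- polarization: `h` vanishes on `U`
    have hpol : ∀ e ∈ U, ∀ c : ℝ, c * c = 1 → S.φ p e = c • e → S.h p e = 0 := by
      intro e he c hc hce
      refine hnd _ (hhU e he) fun w hw ↦ ?_
      rw [hsplit c w, map_add]
      have hw1 := hhalf c w hw
      have hφw1 := S.φ_half hc (hη w hw)
      have hφw2 := S.φ_half (c := -c) (by linarith [neg_mul_neg c c]) (hη w hw)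
      rw [S.g_eq_zero_of_eigen (c := -c) (by linarith [neg_mul_neg c c]) (S.φ_h_eigen hce) hφw2,
        add_zero]
      set w' := (1 / 2 : ℝ) • (w + c • S.φ p w)
      have k1 := H e he c hc hce
      have k2 := H w' hw1 c hc hφw1
      have k3 := H (e + w') (U.add_mem he hw1) c hc (by rw [map_add, hce, hφw1, smul_add])
      have k4 := S.h_symm p w' e
      rw [S.g.symm] at k4
      have k5 := S.g.symm p (S.h p w') e
      have k6 := S.g.symm p (S.h p e) w'
      simp only [map_add, add_apply] at k3
      linarith
    have hzero : ∀ v ∈ U, S.h p v = 0 := by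
      intro v hv
      rw [hsplit 1 v, map_add, hpol _ (hhalf 1 v hv) 1 (by norm_num) (S.φ_half (by norm_num) (hη v hv)),
        hpol _ (hhalf (-1) v hv) (-1) (by norm_num) (S.φ_half (by norm_num) (hη v hv)), add_zero]
    obtain ⟨e, he, c, hc, hce, hne⟩ : ∃ e ∈ U, ∃ c : ℝ, c * c = 1 ∧ S.φ p e = c • e ∧ e ≠ 0 := by
      obtain ⟨v, hv, hv0⟩ := hU
      by_contra! hcon
      apply hv0
      rw [hsplit 1 v, hcon _ (hhalf 1 v hv) 1 (by norm_num) (S.φ_half (by norm_num) (hη v hv)),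
        hcon _ (hhalf (-1) v hv) (-1) (by norm_num) (S.φ_half (by norm_num) (hη v hv)), add_zero]
    obtain ⟨w, hw, hgw⟩ : ∃ w ∈ U, S.g.val p e w ≠ 0 := by
      by_contra! hcon
      exact hne (hnd e he hcon)
    have hc' : (-c) * (-c) = 1 := by linarith [neg_mul_neg c c]
    have hgf : S.g.val p e ((1 / 2 : ℝ) • (w + (-c) • S.φ p w)) ≠ 0 := by
      intro h
      apply hgw
      rw [hsplit c w, map_add, h, S.g_eq_zero_of_eigen hc hce (S.φ_half hc (hη w hw)), add_zero]
    set f := (1 / 2 : ℝ) • (w + (-c) • S.φ p w) with hf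
    have hfU : f ∈ U := hhalf (-c) w hw
    have hφf : S.φ p f = (-c) • f := S.φ_half hc' (hη w hw)
    refine ⟨e, he, (S.g.val p e f)⁻¹ • f, U.smul_mem _ hfU, c, 1, hc, Or.inl rfl, hce, ?_, ?_,
      Or.inr ⟨hzero e he, hzero _ (U.smul_mem _ hfU)⟩⟩
    · rw [map_smul, hφf, smul_comm]
    · rw [map_smul, smul_eq_mul, inv_mul_cancel₀ hgf]

/-! ### Adapted bases and the rank of `h` -/

variable {p : M}

instance (x : M) : FiniteDimensional ℝ (TangentSpace 𝓘(ℝ, Model n) x) :=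
  inferInstanceAs (FiniteDimensional ℝ (Model n))

lemma finrank_tangentSpace (x : M) :
    Module.finrank ℝ (TangentSpace 𝓘(ℝ, Model n) x) = 2 * n + 1 := by
  change Module.finrank ℝ (Model n) = _
  simp

/-- A family of mutually orthogonal hyperbolic pairs `(X_i, Y_i)`, `i ∈ s`, of horizontal
eigenvectors of `φ`, on whose planes `h` has one of the two normal forms. The signs `g(X_i, Y_i)`
and the eigenvalues of `φ` are recorded by `ε` and `c`. -/
structure IsPartialFrame (p : M) (s : Finset (Fin n))
    (X Y : Fin n → TangentSpace 𝓘(ℝ, Model n) p) (ε c : Fin n → ℝ) : Prop where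
  η_X : ∀ i ∈ s, S.η p (X i) = 0
  η_Y : ∀ i ∈ s, S.η p (Y i) = 0
  φ_X : ∀ i ∈ s, S.φ p (X i) = c i • X i
  φ_Y : ∀ i ∈ s, S.φ p (Y i) = (-c i) • Y i
  sign : ∀ i ∈ s, ε i = 1 ∨ ε i = -1
  X_X : ∀ i ∈ s, ∀ j ∈ s, S.g.val p (X i) (X j) = 0
  Y_Y : ∀ i ∈ s, ∀ j ∈ s, S.g.val p (Y i) (Y j) = 0
  X_Y : ∀ i ∈ s, ∀ j ∈ s, S.g.val p (X i) (Y j) = if i = j then ε i else 0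
  h_block : ∀ i ∈ s, (S.h p (X i) = Y i ∧ S.h p (Y i) = 0) ∨ (S.h p (X i) = 0 ∧ S.h p (Y i) = 0)

/-- The orthogonal complement of the Reeb vector and of the vectors `X i`, `Y i`, `i ∈ s`. -/
def perp (p : M) (s : Finset (Fin n)) (X Y : Fin n → TangentSpace 𝓘(ℝ, Model n) p) :
    Submodule ℝ (TangentSpace 𝓘(ℝ, Model n) p) :=
  LinearMap.ker ((S.η p).toLinearMap.prod
    (LinearMap.pi fun i : s ↦ ((S.g.val p (X i)).toLinearMap.prod (S.g.val p (Y i)).toLinearMap)))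

lemma mem_perp {s : Finset (Fin n)} {X Y : Fin n → TangentSpace 𝓘(ℝ, Model n) p}
    {v : TangentSpace 𝓘(ℝ, Model n) p} :
    v ∈ S.perp p s X Y ↔
      S.η p v = 0 ∧ ∀ i ∈ s, S.g.val p (X i) v = 0 ∧ S.g.val p (Y i) v = 0 := by
  simp [perp, funext_iff]

lemma exists_mem_perp {s : Finset (Fin n)} (X Y : Fin n → TangentSpace 𝓘(ℝ, Model n) p)
    (hs : s.card < n) : ∃ v ∈ S.perp p s X Y, v ≠ 0 := by
  apply Submodule.exists_mem_ne_zero_of_ne_bot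
  apply LinearMap.ker_ne_bot_of_finrank_lt
  rw [finrank_tangentSpace]
  simp [Module.finrank_pi_fintype]
  omega

variable {S}

lemma IsPartialFrame.sq {s : Finset (Fin n)} {X Y : Fin n → TangentSpace 𝓘(ℝ, Model n) p}
    {ε c : Fin n → ℝ} (F : S.IsPartialFrame p s X Y ε c) {i : Fin n} (hi : i ∈ s) :
    ε i * ε i = 1 := by
  rcases F.sign i hi with h | h <;> rw [h] <;> norm_num

lemma IsPartialFrame.perp_nondegenerate {s : Finset (Fin n)}
    {X Y : Fin n → TangentSpace 𝓘(ℝ, Model n) p} {ε c : Fin n → ℝ}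
    (F : S.IsPartialFrame p s X Y ε c) {u : TangentSpace 𝓘(ℝ, Model n) p}
    (hu : u ∈ S.perp p s X Y) (h : ∀ w ∈ S.perp p s X Y, S.g.val p u w = 0) : u = 0 := by
  refine S.g.nondegenerate p u fun v ↦ ?_
  rw [mem_perp] at hu
  -- subtract from `v` its orthogonal projection to the span of the frame
  have hv : v - S.η p v • S.ξ p - ∑ i ∈ s, ((ε i * S.g.val p (Y i) v) • X i
      + (ε i * S.g.val p (X i) v) • Y i) ∈ S.perp p s X Y := by
    rw [mem_perp]
    refine ⟨?_, fun j hj ↦ ⟨?_, ?_⟩⟩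
    · rw [map_sub, map_sub, map_sum, Finset.sum_eq_zero]
      · simp [S.η_ξ]
      · intro i hi
        simp [F.η_X i hi, F.η_Y i hi]
    · rw [map_sub, map_sub, map_sum, Finset.sum_eq_single_of_mem j hj]
      · simp only [map_smul, map_add, S.g_ξ_right, F.η_X j hj, F.X_X j hj j hj, F.X_Y j hj j hj,
          smul_eq_mul, if_true]
        linear_combination (-S.g.val p (X j) v) * F.sq hj
      · intro i hi hij
        simp [F.X_X j hj i hi, F.X_Y j hj i hi, hij.symm]
    · rw [map_sub, map_sub, map_sum, Finset.sum_eq_single_of_mem j hj]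
      · simp only [map_smul, map_add, S.g_ξ_right, F.η_Y j hj, F.Y_Y j hj j hj,
          S.g.symm p (Y j) (X j), F.X_Y j hj j hj, smul_eq_mul, if_true]
        linear_combination (-S.g.val p (Y j) v) * F.sq hj
      · intro i hi hij
        simp [F.Y_Y j hj i hi, S.g.symm p (Y j) (X i), F.X_Y i hi j hj, hij]
  have h1 := h _ hv
  rw [map_sub, map_sub, map_sum, Finset.sum_eq_zero] at h1
  · simpa [S.g_ξ_right, hu.1] using h1
  · intro i hi
    simp [S.g.symm p u, (hu.2 i hi).1, (hu.2 i hi).2]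

/-- A frame that does not yet have all `n` pairs can be enlarged by a pair in its orthogonal
complement. -/
lemma IsPartialFrame.extend (hh : ∀ v, S.h p (S.h p v) = 0) {s : Finset (Fin n)}
    {X Y : Fin n → TangentSpace 𝓘(ℝ, Model n) p} {ε c : Fin n → ℝ}
    (F : S.IsPartialFrame p s X Y ε c) {a : Fin n} (ha : a ∉ s) :
    ∃ X' Y' ε' c', S.IsPartialFrame p (insert a s) X' Y' ε' c' := by
  have hs : s.card < n := by
    simpa using Finset.card_lt_univ_of_notMem ha
  have hη : ∀ v ∈ S.perp p s X Y, S.η p v = 0 := fun v hv ↦ (S.mem_perp.1 hv).1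
  have hφ : ∀ v ∈ S.perp p s X Y, S.φ p v ∈ S.perp p s X Y := fun v hv ↦ by
    rw [mem_perp] at hv ⊢
    refine ⟨S.η_φ p v, fun i hi ↦ ?_⟩
    have h1 := S.g_φ_left p (X i) v
    have h2 := S.g_φ_left p (Y i) v
    rw [F.φ_X i hi, map_smul, smul_apply, (hv.2 i hi).1, smul_zero] at h1
    rw [F.φ_Y i hi, map_smul, smul_apply, (hv.2 i hi).2, smul_zero] at h2
    exact ⟨by linarith, by linarith⟩
  have hhU : ∀ v ∈ S.perp p s X Y, S.h p v ∈ S.perp p s X Y := fun v hv ↦ by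
    rw [mem_perp] at hv ⊢
    refine ⟨S.η_h p v, fun i hi ↦ ?_⟩
    rw [← S.h_symm, ← S.h_symm]
    rcases F.h_block i hi with ⟨h1, h2⟩ | ⟨h1, h2⟩ <;> simp [h1, h2, (hv.2 i hi).2]
  obtain ⟨x, hx, y, hy, c₀, ε₀, hc, hε, hφx, hφy, hxy, hb⟩ :=
    S.exists_hyperbolic_pair hh (S.perp p s X Y) hη hφ hhU
      (fun v hv h ↦ F.perp_nondegenerate hv h) (S.exists_mem_perp X Y hs)
  rw [mem_perp] at hx hy
  have hxx : S.g.val p x x = 0 := S.g_eq_zero_of_eigen hc hφx hφx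
  have hyy : S.g.val p y y = 0 :=
    S.g_eq_zero_of_eigen (by linarith [neg_mul_neg c₀ c₀]) hφy hφy
  have hne : ∀ i ∈ s, i ≠ a := fun i hi h ↦ ha (h ▸ hi)
  refine ⟨Function.update X a x, Function.update Y a y, Function.update ε a ε₀,
    Function.update c a c₀, ?_, ?_, ?_, ?_, ?_, ?_, ?_, ?_, ?_⟩ <;>
  simp only [Finset.forall_mem_insert, Function.update_self]
  · exact ⟨hx.1, fun i hi ↦ by simpa [hne i hi] using F.η_X i hi⟩
  · exact ⟨hy.1, fun i hi ↦ by simpa [hne i hi] using F.η_Y i hi⟩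
  · exact ⟨hφx, fun i hi ↦ by simpa [hne i hi] using F.φ_X i hi⟩
  · exact ⟨hφy, fun i hi ↦ by simpa [hne i hi] using F.φ_Y i hi⟩
  · exact ⟨hε, fun i hi ↦ by simpa [hne i hi] using F.sign i hi⟩
  · refine ⟨⟨hxx, fun j hj ↦ ?_⟩, fun i hi ↦ ⟨?_, fun j hj ↦ ?_⟩⟩
    · simpa [hne j hj, S.g.symm p x] using (hx.2 j hj).1
    · simpa [hne i hi] using (hx.2 i hi).1
    · simpa [hne i hi, hne j hj] using F.X_X i hi j hj
  · refine ⟨⟨hyy, fun j hj ↦ ?_⟩, fun i hi ↦ ⟨?_, fun j hj ↦ ?_⟩⟩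
    · simpa [hne j hj, S.g.symm p y] using (hy.2 j hj).2
    · simpa [hne i hi] using (hy.2 i hi).2
    · simpa [hne i hi, hne j hj] using F.Y_Y i hi j hj
  · refine ⟨⟨by simpa using hxy, fun j hj ↦ ?_⟩, fun i hi ↦ ⟨?_, fun j hj ↦ ?_⟩⟩
    · simpa [hne j hj, (hne j hj).symm, S.g.symm p x] using (hx.2 j hj).2
    · simpa [hne i hi] using (hy.2 i hi).1
    · simpa [hne i hi, hne j hj] using F.X_Y i hi j hj
  · exact ⟨hb, fun i hi ↦ by simpa [hne i hi] using F.h_block i hi⟩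

lemma exists_isPartialFrame (hh : ∀ v, S.h p (S.h p v) = 0) (s : Finset (Fin n)) :
    ∃ X Y ε c, S.IsPartialFrame p s X Y ε c := by
  induction s using Finset.induction_on with
  | empty => exact ⟨0, 0, 0, 0, by constructor <;> simp⟩
  | insert a s ha ih =>
    obtain ⟨X, Y, ε, c, F⟩ := ih
    exact F.extend hh ha

lemma exists_isAdapted (hh : ∀ v, S.h p (S.h p v) = 0) : ∃ b, S.IsAdapted p b := by
  obtain ⟨X, Y, ε, c, F⟩ := exists_isPartialFrame hh (Finset.univ : Finset (Fin n))
  have hX_Y := fun i j ↦ F.X_Y i (Finset.mem_univ i) j (Finset.mem_univ j)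
  have hX_X := fun i j ↦ F.X_X i (Finset.mem_univ i) j (Finset.mem_univ j)
  have hY_Y := fun i j ↦ F.Y_Y i (Finset.mem_univ i) j (Finset.mem_univ j)
  have hηX := fun i ↦ F.η_X i (Finset.mem_univ i)
  have hηY := fun i ↦ F.η_Y i (Finset.mem_univ i)
  have hε : ∀ i, ε i ≠ 0 := fun i h ↦ by simpa [h] using F.sq (Finset.mem_univ i)
  let f : Unit ⊕ (Fin n ⊕ Fin n) → TangentSpace 𝓘(ℝ, Model n) p :=
    Sum.elim (fun _ ↦ S.ξ p) (Sum.elim X Y)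
  have hli : LinearIndependent ℝ f := by
    rw [Fintype.linearIndependent_iff]
    intro a ha
    simp only [Fintype.sum_sum_type, f, Sum.elim_inl, Sum.elim_inr, Finset.univ_unique,
      Finset.sum_singleton] at ha
    rintro (_ | i | i)
    · have := congrArg (S.η p) ha
      simpa [S.η_ξ, hηX, hηY] using this
    · have := congrArg (S.g.val p (Y i)) ha
      simpa [S.g_ξ_right, hηY, hY_Y, S.g.symm p (Y i) (X _), hX_Y, hε] using this
    · have := congrArg (S.g.val p (X i)) ha
      simpa [S.g_ξ_right, hηX, hX_X, hX_Y, hε] using this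
  have hcard : Fintype.card (Unit ⊕ (Fin n ⊕ Fin n))
      = Module.finrank ℝ (TangentSpace 𝓘(ℝ, Model n) p) := by
    rw [finrank_tangentSpace]
    simp
    ring
  let b := basisOfLinearIndependentOfCardEqFinrank hli hcard
  have hb : ∀ k, b k = f k := fun k ↦ by simp [b]
  refine ⟨b, ?_, ?_, ?_, ?_, ?_, ?_, ?_, ?_⟩ <;> try simp only [hb, f, Sum.elim_inl, Sum.elim_inr]
  · rw [S.g_ξ_left, S.η_ξ]
  · rintro (i | i) <;> simp [S.g_ξ_left, hηX, hηY]
  · exact hX_X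
  · exact hY_Y
  · intro i j hij
    rw [hX_Y, if_neg hij]
  · intro i
    rw [hX_Y, if_pos rfl]
    exact F.sign i (Finset.mem_univ i)
  · exact fun i ↦ F.h_block i (Finset.mem_univ i)

/-- The rank of `h` is the number of nonzero blocks in an adapted basis. -/
lemma IsAdapted.ncard_eq
    {b : Module.Basis (Unit ⊕ (Fin n ⊕ Fin n)) ℝ (TangentSpace 𝓘(ℝ, Model n) p)}
    (hb : S.IsAdapted p b) :
    {i : Fin n | S.h p (b (.inr (.inl i))) = b (.inr (.inr i))}.ncard = S.rankH p := by
  classical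
  set I := {i : Fin n | S.h p (b (.inr (.inl i))) = b (.inr (.inr i))} with hI
  have hY : ∀ i, S.h p (b (.inr (.inr i))) = 0 := fun i ↦ by
    rcases hb.h_block i with h | h <;> exact h.2
  have hX : ∀ i ∉ I, S.h p (b (.inr (.inl i))) = 0 := fun i hi ↦ by
    rcases hb.h_block i with h | h
    · exact absurd h.1 hi
    · exact h.1
  have hrange : LinearMap.range (S.h p).toLinearMap
      = Submodule.span ℝ (Set.range fun i : I ↦ b (.inr (.inr i.1))) := by
    rw [LinearMap.range_eq_map, ← b.span_eq, Submodule.map_span]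
    apply le_antisymm
    · rw [Submodule.span_le]
      rintro _ ⟨_, ⟨k, rfl⟩, rfl⟩
      rcases k with _ | i | i
      · simp [hb.reeb, S.h_ξ]
      · by_cases hi : i ∈ I
        · exact Submodule.subset_span ⟨⟨i, hi⟩, hi.symm⟩
        · simp [hX i hi]
      · simp [hY i]
    · rw [Submodule.span_le]
      rintro _ ⟨⟨i, hi⟩, rfl⟩
      exact Submodule.subset_span ⟨b (.inr (.inl i)), ⟨_, rfl⟩, hi⟩
  have hli : LinearIndependent ℝ fun i : I ↦ b (.inr (.inr i.1)) :=
    b.linearIndependent.comp (fun i : I ↦ .inr (.inr i.1)) fun i j hij ↦ by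
      simpa [Subtype.ext_iff] using hij
  rw [rankH, hrange, finrank_span_eq_card hli, ← Nat.card_eq_fintype_card, Nat.card_coe_set_eq]

lemma rankH_pos (h : S.h p ≠ 0) : 1 ≤ S.rankH p := by
  rw [rankH, Nat.one_le_iff_ne_zero, Ne, Submodule.finrank_eq_zero, LinearMap.range_eq_bot]
  intro h0
  apply h
  ext1 v
  exact LinearMap.congr_fun h0 v

/-- In dimension three, if the block of `h` is nonzero, then `φ` preserves the line spanned by `Y`,
which is the horizontal part of the kernel of `h`, and skewness of `φ` determines `φ X`. -/
lemma IsAdapted.φ_eq_of_dim_three {M : Type v} [TopologicalSpace M] [ChartedSpace (Model 1) M]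
    [IsManifold 𝓘(ℝ, Model 1) ∞ M] {S : ParacontactMetric 1 M} {p : M}
    {b : Module.Basis (Unit ⊕ (Fin 1 ⊕ Fin 1)) ℝ (TangentSpace 𝓘(ℝ, Model 1) p)}
    (hb : S.IsAdapted p b) {i : Fin 1} (h1 : S.h p (b (.inr (.inl i))) = b (.inr (.inr i)))
    (h2 : S.h p (b (.inr (.inr i))) = 0) :
    (S.φ p (b (.inr (.inl i))) = b (.inr (.inl i)) ∧
        S.φ p (b (.inr (.inr i))) = - b (.inr (.inr i))) ∨
      (S.φ p (b (.inr (.inl i))) = - b (.inr (.inl i)) ∧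
        S.φ p (b (.inr (.inr i))) = b (.inr (.inr i))) := by
  obtain rfl : i = 0 := Subsingleton.elim _ _
  set X := b (.inr (.inl 0)) with hXdef
  set Y := b (.inr (.inr 0)) with hYdef
  have hexp : ∀ v, S.η p v = 0 → ∃ α β : ℝ, v = α • X + β • Y := by
    intro v hv
    have hs := b.sum_repr v
    simp only [Fintype.sum_sum_type, Finset.univ_unique, Finset.sum_singleton, hb.reeb] at hs
    refine ⟨b.repr v (.inr (.inl 0)), b.repr v (.inr (.inr 0)), ?_⟩
    have hX0 : S.η p X = 0 := by rw [← S.g_ξ_left]; exact hb.g_ξ _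
    have hY0 : S.η p Y = 0 := by rw [← S.g_ξ_left]; exact hb.g_ξ _
    have h3 := congrArg (S.η p) hs
    simp only [map_add, map_smul, S.η_ξ, hv, smul_eq_mul, mul_one] at h3
    change _ + (_ * S.η p X + _ * S.η p Y) = _ at h3
    rw [hX0, hY0, mul_zero, mul_zero, add_zero, add_zero] at h3
    rw [h3, zero_smul, zero_add] at hs
    exact hs.symm
  have hYne : Y ≠ 0 := b.ne_zero _
  have hgXY : S.g.val p X Y ≠ 0 := by
    rcases hb.g_X_Y 0 with h | h <;> rw [h] <;> norm_num
  have hXX : S.g.val p X X = 0 := hb.g_X_X 0 0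
  have hYX := S.g.symm p Y X
  have hηY : S.η p Y = 0 := by rw [← S.g_ξ_left]; exact hb.g_ξ _
  obtain ⟨α, β, hφY⟩ := hexp _ (S.η_φ p Y)
  obtain ⟨γ, δ, hφX⟩ := hexp _ (S.η_φ p X)
  -- `φ Y` lies in the kernel of `h`
  have hα : α = 0 := by
    have h3 := S.h_φ p Y
    rw [h2, map_zero, neg_zero, hφY, map_add, map_smul, map_smul, h1, h2, smul_zero,
      add_zero] at h3
    exact (smul_eq_zero.1 h3).resolve_right hYne
  rw [hα, zero_smul, zero_add] at hφY
  have hβ : β * β = 1 := by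
    have h3 := S.φ_sq p Y
    rw [hηY, zero_smul, sub_zero, hφY, map_smul, hφY, smul_smul] at h3
    have h4 : (β * β - 1) • Y = 0 := by rw [sub_smul, h3, one_smul, sub_self]
    linarith [(smul_eq_zero.1 h4).resolve_right hYne]
  have hδ : δ = 0 := by
    have h3 := S.g_φ_left p X X
    rw [hφX] at h3
    simp only [map_add, map_smul, add_apply, smul_apply, smul_eq_mul, hXX, hYX] at h3
    have h4 : δ * S.g.val p X Y = 0 := by linarith
    exact (mul_eq_zero.1 h4).resolve_right hgXY
  rw [hδ, zero_smul, add_zero] at hφX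
  have hγ : γ = -β := by
    have h3 := S.g_φ_left p X Y
    rw [hφX, hφY] at h3
    simp only [map_smul, smul_apply, smul_eq_mul] at h3
    have h4 : (γ + β) * S.g.val p X Y = 0 := by linarith
    linarith [(mul_eq_zero.1 h4).resolve_right hgXY]
  rcases mul_self_eq_one_iff.1 hβ with h | h
  · right
    rw [hφX, hφY, hγ, h]
    simp
  · left
    rw [hφX, hφY, hγ, h]
    simp

end ParacontactMetric

end Paracontact

end

open Paracontact in
theorem theorem2p1 (n : ℕ) (M : Type*) [TopologicalSpace M] [ChartedSpace (Model n) M]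
    [IsManifold 𝓘(ℝ, Model n) ∞ M] (S : ParacontactMetric n M) (μ : ℝ)
    (hS : S.IsKappaMuSpace (-1) μ) :
    ((∀ p, S.h p = 0) ∧ S.IsParaSasakian) ∨
    ((∃ p, S.h p ≠ 0) ∧
      ∀ p, S.h p ≠ 0 →
        (1 ≤ S.rankH p ∧ S.rankH p ≤ n) ∧
        (∃ b, S.IsAdapted p b) ∧
        ∀ b, S.IsAdapted p b →
          {i : Fin n | S.h p (b (.inr (.inl i))) = b (.inr (.inr i))}.ncard = S.rankH p ∧
          (n = 1 → ∀ i : Fin n,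
            ((S.φ p (b (.inr (.inl i))) = b (.inr (.inl i)) ∧
                S.φ p (b (.inr (.inr i))) = - b (.inr (.inr i))) ∨
              (S.φ p (b (.inr (.inl i))) = - b (.inr (.inl i)) ∧
                S.φ p (b (.inr (.inr i))) = b (.inr (.inr i)))) ∧
            S.h p (S.ξ p) = 0 ∧
            S.h p (b (.inr (.inl i))) = b (.inr (.inr i)) ∧
            S.h p (b (.inr (.inr i))) = 0)) := by
  by_cases h0 : ∀ p, S.h p = 0
  · exact Or.inl ⟨h0, S.isParaSasakian hS h0⟩
  push Not at h0
  refine Or.inr ⟨h0, fun p hp ↦ ?_⟩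
  have hh := S.h_h hS p
  have hex := ParacontactMetric.exists_isAdapted hh
  refine ⟨⟨S.rankH_pos hp, ?_⟩, hex, fun b hb ↦ ⟨hb.ncard_eq, ?_⟩⟩
  · obtain ⟨b, hb⟩ := hex
    rw [← hb.ncard_eq]
    exact (Set.ncard_le_card _).trans_eq (by simp)
  · rintro rfl i
    -- the rank of `h` is positive, so the only block is of the first type
    have hi : S.h p (b (.inr (.inl i))) = b (.inr (.inr i)) := by
      have h1 := S.rankH_pos hp
      rw [← hb.ncard_eq, Nat.one_le_iff_ne_zero] at h1
      obtain ⟨j, hj⟩ := Set.nonempty_of_ncard_ne_zero h1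
      rwa [Subsingleton.elim i j]
    have hi' : S.h p (b (.inr (.inr i))) = 0 := by
      rcases hb.h_block i with h | h <;> exact h.2
    exact ⟨hb.φ_eq_of_dim_three hi hi', S.h_ξ p, hi, hi'⟩
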